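/- Let $d\ge 1$, $n\ge d+1$, and let $\xi_1,\dots,\xi_n$ be random vectors in $\mathbb R^d$ on a common probability space, with partial sums $S_i=\xi_1+\dots+\xi_i$, $1\le i\le n$. Assume: ($\pm$Ex) for every permutation $\sigma$ of $\{1,\dots,n\}$ and all $\varepsilon_1,\dots,\varepsilon_n\in\{-1,+1\}$, the tuples $(\xi_1,\dots,\xi_n)$ and $(\varepsilon_1\xi_{\sigma(1)},\dots,\varepsilon_n\xi_{\sigma(n)})$ have the same distribution; (GP) for all $1\le i_1<\dots<i_d\le n$, the vectors $S_{i_1},\dots,S_{i_d}$ are linearly dependent with probability $0$. For $1\le k\le m\le n$ put $$M_{m,k}^{(d)}=\frac12\sum_{1\le i_1<\dots<i_k\le m}\mathbf 1_{\{0\notin\mathrm{Conv}(S_{i_1},\dots,S_{i_k})\}},$$ where $\mathrm{Conv}$ is the convex hull, and define $B(k,j)$ by $(t+1)(t+3)\cdots(t+2k-1)=\sum_{j=0}^k B(k,j)t^j$, with $B(k,j)=0$ for $j<0$ and $j>k$. Then for every $k=1,\dots,n$, $$\mathbb E M_{n,k}^{(d)}=\binom nk\,\frac{B(k,d-1)+B(k,d-3)+\cdots}{2^k\,k!}=\binom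 nk\,\mathbb E M_{k,k}^{(d)}.$$ For $d=1$ this recovers the discrete arcsine law in the form of its factorial moments: if $N_n$ is the number of $i\in\{1,\dots,n\}$ with $S_i>0$, then $\mathbb E\binom{N_n}{k}=\frac1{2^{2k}}\binom{2k}{k}\binom nk$ for every $k=1,\dots,n$. -/

import Mathlib

namespace ArcsineLaw

open MeasureTheory ProbabilityTheory

noncomputable section

/-- The partial sums of a finite sequence of increments. The index is zero-based: for
`ξ = (ξ₁, …, ξₙ)`, the value at `i : Fin n` is `S_{i+1} = ξ₁ + … + ξ_{i+1}`. -/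
def walk {E : Type*} [AddCommMonoid E] {n : ℕ} (ξ : Fin n → E) (i : Fin n) : E :=
  ∑ j ∈ Finset.Iic i, ξ j

/-- Symmetric exchangeability (±Ex): the joint law of the increments is invariant under all
permutations and all changes of signs. -/
def SymmExchangeable {Ω : Type*} [MeasurableSpace Ω] (μ : Measure Ω) {n d : ℕ}
    (ξ : Fin n → Ω → EuclideanSpace ℝ (Fin d)) : Prop :=
  ∀ (σ : Equiv.Perm (Fin n)) (ε : Fin n → ℝ), (∀ i, ε i = -1 ∨ ε i = 1) →
    IdentDistrib (fun ω i => ξ i ω) (fun ω i => ε i • ξ (σ i) ω) μ μ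

/-- General position (GP): for all `i₁ < … < i_d`, the vectors `S_{i₁}, …, S_{i_d}` are linearly
dependent with probability zero. -/
def GeneralPosition {Ω : Type*} [MeasurableSpace Ω] (μ : Measure Ω) {n d : ℕ}
    (ξ : Fin n → Ω → EuclideanSpace ℝ (Fin d)) : Prop :=
  ∀ i : Fin d → Fin n, StrictMono i →
    μ {ω | ¬ LinearIndependent ℝ (fun l : Fin d => walk (fun j => ξ j ω) (i l))} = 0

open Classical in
/-- Half the number of `k`-element sets of indices `i₁ < … < i_k` such that the convex hull of
`x_{i₁}, …, x_{i_k}` does not contain the origin. -/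
def halfCount {d n : ℕ} (k : ℕ) (x : Fin n → EuclideanSpace ℝ (Fin d)) : ℝ :=
  (1 / 2 : ℝ) * ∑ I ∈ Finset.powersetCard k (Finset.univ : Finset (Fin n)),
    if (0 : EuclideanSpace ℝ (Fin d)) ∉ convexHull ℝ (x '' (I : Set (Fin n))) then (1 : ℝ) else 0

/-- The random variable `M_{n,k}^{(d)}` of the walk with increments `ξ₁, …, ξₙ`. -/
def M {Ω : Type*} {d n : ℕ} (k : ℕ) (ξ : Fin n → Ω → EuclideanSpace ℝ (Fin d)) (ω : Ω) : ℝ :=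
  halfCount k (walk (fun j => ξ j ω))

/-- The coefficient `B(k, j)` of `t ^ j` in `(t + 1)(t + 3) ⋯ (t + 2k - 1)`, and zero
for negative `j` (it vanishes for `j > k` by degree). -/
def B (k : ℕ) (j : ℤ) : ℕ :=
  if j < 0 then 0
  else (∏ i ∈ Finset.range k, (Polynomial.X + Polynomial.C (2 * i + 1) : Polynomial ℕ)).coeff
    j.toNat

/-- The sum `B(k, d-1) + B(k, d-3) + …`; every term with `m ≥ d` has a negative second index
and so vanishes. -/
def sumB (k d : ℕ) : ℕ :=
  ∑ m ∈ Finset.range d, B k ((d : ℤ) - 1 - 2 * (m : ℤ))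

/-- The number of positive terms of a finite real sequence. -/
def numPos {n : ℕ} (x : Fin n → ℝ) : ℕ :=
  (Finset.univ.filter (fun i => 0 < x i)).card

end

end ArcsineLaw

namespace ArcsineLaw

open Finset MeasureTheory ProbabilityTheory

/-! ### Recursions for the alternate coefficient sums of (t + 1)(t + 3) ⋯ (t + 2k - 1). -/

section Coefficients

/-! Fix an outcome and a walk with increments η_1, …, η_k. By Abel summation, weights on the
positions of the walk become a decreasing sequence of coefficients on the increments. For generic
increments, 0 therefore lies in the convex hull exactly when the relation space L = {z : Σ z_j η_j =
0} meets the chamber z_1 > … > z_k > 0 (`Generic.zero_mem_convexHull_walk_iff`). Signing and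
permuting the increments runs this chamber through all 2^k k! chambers of the reflection arrangement
of type B. So the number of signed permutations whose walk avoids 0 is the number of chambers missed
by L.

For generic L this number is deterministic (`card_regions_add`). The chambers are counted by
inserting one coordinate at a time: over a region of the first k coordinates, the new one can take
one more position than there are walls z_{k+1} = ± z_i or 0 met by that region. The resulting
recursion is that of `sumB`.

The probabilistic part is an average. Indices i_1 < … < i_k cut the increments into blocks, and the
walk at these indices is the walk of the block sums. Signing and permuting the blocks acts on the
increments by a signed permutation and on the index choices by a bijection, so the expected count,
summed over all choices, can be averaged over the group (`sum_avoidProb`). The genericity needed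
holds almost surely by `ae_generic`: sorting the coefficients of a relation by absolute value turns
it into a relation between few positions of a signed and permuted walk. -/

theorem B_of_neg (k : ℕ) {j : ℤ} (hj : j < 0) : B k j = 0 := by simp [B, hj]

theorem B_natCast (k j : ℕ) :
    B k (j : ℤ) = (∏ i ∈ range k,
      (Polynomial.X + Polynomial.C (2 * i + 1) : Polynomial ℕ)).coeff j := by
  simp [B]

theorem B_succ (k : ℕ) (j : ℤ) : B (k + 1) j = (2 * k + 1) * B k j + B k (j - 1) := by
  rcases lt_or_ge j 0 with hj | hj
  · rw [B_of_neg _ hj, B_of_neg _ hj, B_of_neg _ (by lia)]; simp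
  obtain ⟨m, rfl⟩ := Int.eq_ofNat_of_zero_le hj
  rw [B_natCast, B_natCast, prod_range_succ, mul_add, Polynomial.coeff_add,
    Polynomial.coeff_mul_C]
  cases m with
  | zero =>
    rw [Polynomial.coeff_mul_X_zero, B_of_neg _ (by simp)]
    ring
  | succ m =>
    rw [Polynomial.coeff_mul_X]
    have : ((m + 1 : ℕ) : ℤ) - 1 = (m : ℤ) := by push_cast; ring
    rw [this, B_natCast]
    ring

/-- Multiplying by t + (2k + 1) gives `B_succ`, and lowering every second index by one turns the sum
for d + 1 into that for d. The factor 2k + 1 will match the number of walls in `card_regions_succ`.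
-/
theorem sumB_succ_succ (k d : ℕ) :
    sumB (k + 1) (d + 1) = (2 * k + 1) * sumB k (d + 1) + sumB k d := by
  -- The added summand m = d has second index -d - 1 and vanishes.
  have h : sumB k d = ∑ m ∈ range (d + 1), B k ((d : ℤ) - 1 - 2 * (m : ℤ)) := by
    rw [sum_range_succ, B_of_neg _ (by lia)]; rfl
  rw [h, sumB, sumB, mul_sum, ← sum_add_distrib]
  refine sum_congr rfl fun m _ => ?_
  rw [B_succ]
  congr 2
  push_cast; ring

theorem sumB_zero (k : ℕ) : sumB k 0 = 0 := by simp [sumB]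

theorem sumB_one (k : ℕ) : sumB k 1 = B k 0 := by simp [sumB]

theorem sumB_add_two (k d : ℕ) : sumB k (d + 2) = B k (d + 1 : ℕ) + sumB k d := by
  have h : sumB k d = ∑ m ∈ range (d + 1), B k ((d : ℤ) - 1 - 2 * (m : ℤ)) := by
    rw [sum_range_succ, B_of_neg _ (by lia)]; rfl
  rw [h, sumB, sum_range_succ', add_comm]
  congr 1
  · congr 1; push_cast; ring
  · refine sum_congr rfl fun m _ => ?_
    congr 1; push_cast; ring

theorem B_one_natCast (j : ℕ) : B 1 (j : ℤ) = if j ≤ 1 then 1 else 0 := by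
  rw [B_natCast]
  simp only [range_one, prod_singleton, mul_zero, zero_add, map_one,
    Polynomial.coeff_add, Polynomial.coeff_X, Polynomial.coeff_one]
  rcases j with _ | _ | j <;> simp

theorem sumB_one_succ (d : ℕ) : sumB 1 (d + 1) = 1 := by
  induction d using Nat.strong_induction_on with
  | _ d ih =>
    rcases d with _ | _ | d
    · rw [sumB_one]; exact B_one_natCast 0
    · rw [sumB_add_two, B_one_natCast, sumB_zero]; simp
    · rw [sumB_add_two, B_one_natCast, ih d (by lia)]; simp

/-- Here the sum contains all coefficients of one parity. As -1 is a root, both parities have the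
same sum, half of the value 2·4⋯2k at t = 1. The recursion gives the same by induction. -/
theorem two_mul_sumB_of_le {k d : ℕ} (hk : 1 ≤ k) (hd : k ≤ d) :
    2 * sumB k d = 2 ^ k * k.factorial := by
  induction k, hk using Nat.le_induction generalizing d with
  | base =>
    obtain ⟨d, rfl⟩ := Nat.exists_eq_add_of_le' hd
    simp [sumB_one_succ]
  | succ k hk ih =>
    obtain ⟨d, rfl⟩ : ∃ e, d = e + 1 := ⟨d - 1, by lia⟩
    have h1 := ih (d := d + 1) (by lia)
    have h2 := ih (d := d) (by lia)
    rw [sumB_succ_succ, Nat.factorial_succ, pow_succ]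
    linear_combination (2 * k + 1) * h1 + h2

end Coefficients

/-! ### Regions cut out in a subspace by the arrangement of type B. -/

section Regions

variable {U : Type*} [AddCommGroup U] [Module ℝ U]

/-- The odd extension to `ℤ` of a sequence of linear forms: `signedForm y (j + 1) = y j`,
`signedForm y (-(j + 1)) = -y j` and `signedForm y 0 = 0`. -/
noncomputable def signedForm (y : ℕ → U →ₗ[ℝ] ℝ) (i : ℤ) : U →ₗ[ℝ] ℝ :=
  (i.sign : ℝ) • y (i.natAbs - 1)

theorem signedForm_zero (y : ℕ → U →ₗ[ℝ] ℝ) : signedForm y 0 = 0 := by simp [signedForm]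

theorem signedForm_neg (y : ℕ → U →ₗ[ℝ] ℝ) (i : ℤ) (u : U) :
    signedForm y (-i) u = -signedForm y i u := by simp [signedForm]

theorem signedForm_succ (y : ℕ → U →ₗ[ℝ] ℝ) (j : ℕ) : signedForm y (j + 1) = y j := by
  have h : ((j : ℤ) + 1).natAbs = j + 1 := by lia
  simp [signedForm, h, Int.sign_eq_one_of_pos (show (0 : ℤ) < j + 1 by lia)]

/-- The set of signed indices up to `k`. -/
noncomputable def signedIndices (k : ℕ) : Finset ℤ := Icc (-(k : ℤ)) k

theorem mem_signedIndices {k : ℕ} {i : ℤ} : i ∈ signedIndices k ↔ -(k : ℤ) ≤ i ∧ i ≤ k := by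
  simp [signedIndices]

theorem card_signedIndices (k : ℕ) : #(signedIndices k) = 2 * k + 1 := by
  simp only [signedIndices, Int.card_Icc]; lia

theorem mem_signedIndices_succ {k : ℕ} {i : ℤ} :
    i ∈ signedIndices (k + 1) ↔ i ∈ signedIndices k ∨ i = k + 1 ∨ i = -(k + 1) := by
  simp only [mem_signedIndices]; push_cast; lia

theorem neg_mem_signedIndices {k : ℕ} {i : ℤ} (h : i ∈ signedIndices k) :
    -i ∈ signedIndices k := by
  simp only [mem_signedIndices] at *; lia

theorem zero_mem_signedIndices (k : ℕ) : 0 ∈ signedIndices k := by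
  simp [mem_signedIndices]

theorem signedIndices_subset_succ (k : ℕ) : signedIndices k ⊆ signedIndices (k + 1) :=
  fun _ h => mem_signedIndices_succ.2 (Or.inl h)

/-- A vector is regular when it lies on none of the hyperplanes `y i = 0`, `y i = ± y j`
for distinct `i, j < k`. -/
def Regular (y : ℕ → U →ₗ[ℝ] ℝ) (k : ℕ) (u : U) : Prop :=
  ∀ i ∈ signedIndices k, ∀ j ∈ signedIndices k, signedForm y i u = signedForm y j u → i = j

/-- The order relation induced by a vector on the signed indices. -/
noncomputable def orderType (y : ℕ → U →ₗ[ℝ] ℝ) (k : ℕ) (u : U) : Finset (ℤ × ℤ) :=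
  (signedIndices k ×ˢ signedIndices k).filter fun p => signedForm y p.1 u < signedForm y p.2 u

open Classical in
/-- The regions cut out in the subspace `L` by the hyperplanes `y i = 0`, `y i = ± y j`, each
encoded by the order type of its points. -/
noncomputable def regions (y : ℕ → U →ₗ[ℝ] ℝ) (k : ℕ) (L : Submodule ℝ U) :
    Finset (Finset (ℤ × ℤ)) :=
  ((signedIndices k ×ˢ signedIndices k).powerset).filter
    fun r => ∃ u ∈ L, Regular y k u ∧ orderType y k u = r

variable {y : ℕ → U →ₗ[ℝ] ℝ} {k : ℕ} {L : Submodule ℝ U} {u w : U} {r : Finset (ℤ × ℤ)}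

theorem mem_orderType {i j : ℤ} : (i, j) ∈ orderType y k u ↔
    (i ∈ signedIndices k ∧ j ∈ signedIndices k) ∧ signedForm y i u < signedForm y j u := by
  simp [orderType]

theorem mem_regions : r ∈ regions y k L ↔ ∃ u ∈ L, Regular y k u ∧ orderType y k u = r := by
  classical
  simp only [regions, mem_filter, mem_powerset, and_iff_right_iff_imp]
  rintro ⟨u, -, -, rfl⟩
  exact filter_subset _ _

theorem regions_mono {L' : Submodule ℝ U} (h : L ≤ L') : regions y k L ⊆ regions y k L' := by
  intro r hr
  obtain ⟨u, hu, h2⟩ := mem_regions.1 hr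
  exact mem_regions.2 ⟨u, h hu, h2⟩

theorem orderType_eq_iff : orderType y k u = orderType y k w ↔
    ∀ i ∈ signedIndices k, ∀ j ∈ signedIndices k,
      (signedForm y i u < signedForm y j u ↔ signedForm y i w < signedForm y j w) := by
  constructor
  · intro h i hi j hj
    have := congrArg (fun s => (i, j) ∈ s) h
    simpa [mem_orderType, hi, hj] using this
  · intro h
    ext ⟨i, j⟩
    rw [mem_orderType, mem_orderType]
    exact and_congr_right fun hij => h i hij.1 j hij.2

/-- Comparisons with -(k + 1) follow from those with k + 1 by oddness; equality of the values at k +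
1 and -(k + 1) would make both equal to the value 0 at index 0. -/
theorem regular_succ_iff : Regular y (k + 1) u ↔
    Regular y k u ∧ ∀ j ∈ signedIndices k, signedForm y j u ≠ signedForm y (k + 1) u := by
  constructor
  · intro h
    refine ⟨fun i hi j hj => h i (signedIndices_subset_succ k hi) j
      (signedIndices_subset_succ k hj), fun j hj hjk => ?_⟩
    have := h j (signedIndices_subset_succ k hj) (k + 1)
      (mem_signedIndices_succ.2 (Or.inr (Or.inl rfl))) hjk
    rw [mem_signedIndices] at hj; lia
  · rintro ⟨h1, h2⟩ i hi j hj hij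
    have h0 := h2 0 (zero_mem_signedIndices k)
    rw [signedForm_zero, LinearMap.zero_apply] at h0
    rw [mem_signedIndices_succ] at hi hj
    rcases hi with hi | rfl | rfl <;> rcases hj with hj | rfl | rfl
    · exact h1 i hi j hj hij
    · exact absurd hij (h2 i hi)
    · refine absurd ?_ (h2 (-i) (neg_mem_signedIndices hi))
      rw [signedForm_neg, hij, signedForm_neg, neg_neg]
    · exact absurd hij.symm (h2 j hj)
    · rfl
    · rw [signedForm_neg] at hij
      exact absurd (by linarith) h0
    · refine absurd ?_ (h2 (-j) (neg_mem_signedIndices hj))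
      rw [signedForm_neg, ← hij, signedForm_neg, neg_neg]
    · rw [signedForm_neg] at hij
      exact absurd (by linarith) h0
    · rfl

/-- The number of signed indices preceding `i` in an order type. -/
noncomputable def orderRank (k : ℕ) (r : Finset (ℤ × ℤ)) (i : ℤ) : ℕ :=
  #((signedIndices k).filter fun j => (j, i) ∈ r)

/-- The number of signed indices up to `k` whose value precedes that of `k + 1`. -/
noncomputable def position (y : ℕ → U →ₗ[ℝ] ℝ) (k : ℕ) (u : U) : ℕ :=
  #((signedIndices k).filter fun j => signedForm y j u < signedForm y (k + 1) u)

theorem orderRank_orderType {i : ℤ} (hi : i ∈ signedIndices k) :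
    orderRank k (orderType y k u) i =
      #((signedIndices k).filter fun j => signedForm y j u < signedForm y i u) := by
  rw [orderRank]
  congr 1
  refine filter_congr fun j hj => ?_
  simp [mem_orderType, hi, hj]

theorem orderRank_lt_position {i : ℤ} (hi : i ∈ signedIndices k)
    (h : signedForm y i u < signedForm y (k + 1) u) :
    orderRank k (orderType y k u) i < position y k u := by
  rw [orderRank_orderType hi, position]
  refine card_lt_card ((ssubset_iff_of_subset ?_).2 ⟨i, by simp [hi, h], by simp⟩)
  intro j hj
  rw [mem_filter] at hj ⊢
  exact ⟨hj.1, hj.2.trans h⟩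

/-- Ranks depend only on the order type, so order type and position together decide every comparison
between an old value and the new one. -/
theorem orderRank_lt_position_iff {i : ℤ} (hi : i ∈ signedIndices k) :
    orderRank k (orderType y k u) i < position y k u ↔
      signedForm y i u < signedForm y (k + 1) u := by
  refine ⟨fun h => ?_, orderRank_lt_position hi⟩
  by_contra! hle
  refine absurd h (not_lt.2 ?_)
  rw [orderRank_orderType hi, position]
  refine card_le_card fun j hj => ?_
  rw [mem_filter] at hj ⊢
  exact ⟨hj.1, hj.2.trans_le hle⟩

theorem orderRank_injOn (hu : Regular y k u) :
    Set.InjOn (orderRank k (orderType y k u)) (signedIndices k) := by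
  have key : ∀ i ∈ signedIndices k, ∀ j ∈ signedIndices k,
      signedForm y i u < signedForm y j u →
      orderRank k (orderType y k u) i < orderRank k (orderType y k u) j := by
    intro i hi j hj h
    rw [orderRank_orderType hi, orderRank_orderType hj]
    refine card_lt_card ((ssubset_iff_of_subset ?_).2 ⟨i, by simp [hi, h], by simp⟩)
    intro l hl
    rw [mem_filter] at hl ⊢
    exact ⟨hl.1, hl.2.trans h⟩
  intro i hi j hj hij
  rcases lt_trichotomy (signedForm y i u) (signedForm y j u) with h | h | h
  · exact absurd hij (key i hi j hj h).ne
  · exact hu i hi j hj h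
  · exact absurd hij (key j hj i hi h).ne'

theorem orderRank_lt {i : ℤ} (hi : i ∈ signedIndices k) :
    orderRank k (orderType y k u) i < 2 * k + 1 := by
  rw [orderRank_orderType hi, ← card_signedIndices]
  refine card_lt_card ((ssubset_iff_of_subset (filter_subset _ _)).2 ⟨i, hi, by simp⟩)

theorem exists_orderRank_eq (hu : Regular y k u) {s : ℕ} (hs : s < 2 * k + 1) :
    ∃ i ∈ signedIndices k, orderRank k (orderType y k u) i = s := by
  have h : (signedIndices k).image (orderRank k (orderType y k u)) = range (2 * k + 1) := by
    refine eq_of_subset_of_card_le ?_ ?_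
    · intro s hs
      obtain ⟨i, hi, rfl⟩ := mem_image.1 hs
      exact mem_range.2 (orderRank_lt hi)
    · rw [card_image_of_injOn (orderRank_injOn hu), card_range, card_signedIndices]
  have := mem_range.2 hs
  rw [← h, mem_image] at this
  exact this

theorem position_le : position y k u ≤ 2 * k + 1 := by
  rw [← card_signedIndices]; exact card_le_card (filter_subset _ _)

/-- Small perturbations along a line preserve strict inequalities between signed forms. -/
theorem eventually_signedForm_lt {i j : ℤ} (w : U) (h : signedForm y i u < signedForm y j u) :
    ∀ᶠ t : ℝ in nhds 0, signedForm y i (u + t • w) < signedForm y j (u + t • w) := by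
  have h1 : ∀ l : ℤ, Continuous fun t : ℝ => signedForm y l (u + t • w) := by
    intro l
    simp only [map_add, map_smul]
    fun_prop
  exact (h1 i).continuousAt.eventually_lt (h1 j).continuousAt (by simpa using h)

/-- A region is given by finitely many strict inequalities, hence is open along every line. -/
theorem eventually_orderType_eq (hu : Regular y k u) (w : U) :
    ∀ᶠ t : ℝ in nhds 0, Regular y k (u + t • w) ∧
      orderType y k (u + t • w) = orderType y k u := by
  have h : ∀ᶠ t : ℝ in nhds 0, ∀ p ∈ signedIndices k ×ˢ signedIndices k,
      signedForm y p.1 u < signedForm y p.2 u →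
      signedForm y p.1 (u + t • w) < signedForm y p.2 (u + t • w) := by
    rw [Finset.eventually_all]
    intro p hp
    by_cases hlt : signedForm y p.1 u < signedForm y p.2 u
    · filter_upwards [eventually_signedForm_lt w hlt] with t ht _ using ht
    · exact Filter.Eventually.of_forall fun t ht => absurd ht hlt
  filter_upwards [h] with t ht
  have hlt : ∀ i ∈ signedIndices k, ∀ j ∈ signedIndices k,
      signedForm y i u < signedForm y j u →
      signedForm y i (u + t • w) < signedForm y j (u + t • w) :=
    fun i hi j hj => ht (i, j) (mk_mem_product hi hj)
  refine ⟨fun i hi j hj hij => ?_, orderType_eq_iff.2 fun i hi j hj =>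
    ⟨fun hij => ?_, hlt i hi j hj⟩⟩
  · rcases lt_trichotomy (signedForm y i u) (signedForm y j u) with h | h | h
    · exact absurd hij (hlt i hi j hj h).ne
    · exact hu i hi j hj h
    · exact absurd hij (hlt j hj i hi h).ne'
  · rcases lt_trichotomy (signedForm y i u) (signedForm y j u) with h | h | h
    · exact h
    · rw [hu i hi j hj h] at hij; exact absurd hij (lt_irrefl _)
    · exact absurd hij (hlt j hj i hi h).le.not_gt

open Classical in
/-- The positions of the value of index `k + 1` that occur over the region `r`. -/
noncomputable def positions (y : ℕ → U →ₗ[ℝ] ℝ) (k : ℕ) (L : Submodule ℝ U)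
    (r : Finset (ℤ × ℤ)) : Finset ℕ :=
  (range (2 * k + 2)).filter
    fun p => ∃ u ∈ L, Regular y (k + 1) u ∧ orderType y k u = r ∧ position y k u = p

theorem mem_positions {p : ℕ} : p ∈ positions y k L r ↔
    ∃ u ∈ L, Regular y (k + 1) u ∧ orderType y k u = r ∧ position y k u = p := by
  classical
  simp only [positions, mem_filter, mem_range, and_iff_right_iff_imp]
  rintro ⟨u, -, -, -, rfl⟩
  exact Nat.lt_succ_of_le position_le

/-- The part of `L` on which the value of index `k + 1` equals the value of index `i`. -/
noncomputable def wall (y : ℕ → U →ₗ[ℝ] ℝ) (k : ℕ) (L : Submodule ℝ U) (i : ℤ) :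
    Submodule ℝ U :=
  L ⊓ LinearMap.ker (signedForm y (k + 1) - signedForm y i)

theorem mem_wall {i : ℤ} :
    u ∈ wall y k L i ↔ u ∈ L ∧ signedForm y (k + 1) u = signedForm y i u := by
  simp [wall, sub_eq_zero]

/-- Next to a wall met by a region, both neighbouring positions occur. -/
theorem orderRank_mem_positions {i : ℤ} (hi : i ∈ signedIndices k)
    (hw : ∃ w ∈ L, signedForm y (k + 1) w ≠ signedForm y i w)
    (hr : r ∈ regions y k (wall y k L i)) :
    orderRank k r i ∈ positions y k L r ∧ orderRank k r i + 1 ∈ positions y k L r := by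
  obtain ⟨u, hu, hreg, rfl⟩ := mem_regions.1 hr
  rw [mem_wall] at hu
  -- Orient `w` so that moving along it raises the value at k + 1 relative to that at `i`.
  obtain ⟨w, hwL, hw⟩ : ∃ w ∈ L, signedForm y i w < signedForm y (k + 1) w := by
    obtain ⟨w, hwL, hw⟩ := hw
    rcases lt_or_gt_of_ne hw with h | h
    · exact ⟨-w, L.neg_mem hwL, by simpa using h⟩
    · exact ⟨w, hwL, h⟩
  have hev : ∀ᶠ t : ℝ in nhds 0, (Regular y k (u + t • w) ∧
      orderType y k (u + t • w) = orderType y k u) ∧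
      ∀ j ∈ signedIndices k, (signedForm y j u < signedForm y (k + 1) u →
          signedForm y j (u + t • w) < signedForm y (k + 1) (u + t • w)) ∧
        (signedForm y (k + 1) u < signedForm y j u →
          signedForm y (k + 1) (u + t • w) < signedForm y j (u + t • w)) := by
    refine (eventually_orderType_eq hreg w).and ?_
    rw [Finset.eventually_all]
    intro j hj
    refine Filter.Eventually.and ?_ ?_
    · by_cases h : signedForm y j u < signedForm y (k + 1) u
      · filter_upwards [eventually_signedForm_lt w h] with t ht _ using ht
      · exact Filter.Eventually.of_forall fun t ht => absurd ht h
    · by_cases h : signedForm y (k + 1) u < signedForm y j u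
      · filter_upwards [eventually_signedForm_lt w h] with t ht _ using ht
      · exact Filter.Eventually.of_forall fun t ht => absurd ht h
  obtain ⟨δ, hδ, hball⟩ := Metric.eventually_nhds_iff.1 hev
  -- Near the wall, only the comparison of `i` with k + 1 depends on the sign of `t`; all others are
  -- strict at `u` and persist.
  have main : ∀ t : ℝ, t ≠ 0 → dist t 0 < δ →
      u + t • w ∈ L ∧ Regular y (k + 1) (u + t • w) ∧
      orderType y k (u + t • w) = orderType y k u ∧
      position y k (u + t • w) =
        #((signedIndices k).filter fun j => signedForm y j u < signedForm y i u ∨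
          j = i ∧ 0 < t) := by
    intro t ht0 htd
    obtain ⟨⟨h1, h2⟩, h3⟩ := hball htd
    have hval : signedForm y (k + 1) (u + t • w) - signedForm y i (u + t • w) =
        t * (signedForm y (k + 1) w - signedForm y i w) := by
      simp only [map_add, map_smul, hu.2, smul_eq_mul]; ring
    have hcmp : ∀ j ∈ signedIndices k,
        signedForm y j (u + t • w) ≠ signedForm y (k + 1) (u + t • w) ∧
        (signedForm y j (u + t • w) < signedForm y (k + 1) (u + t • w) ↔
          signedForm y j u < signedForm y i u ∨ j = i ∧ 0 < t) := by
      intro j hj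
      rcases lt_trichotomy (signedForm y j u) (signedForm y (k + 1) u) with h | h | h
      · have := (h3 j hj).1 h
        exact ⟨this.ne, iff_of_true this (Or.inl (hu.2 ▸ h))⟩
      · have hji : j = i := hreg j hj i hi (h.trans hu.2)
        subst hji
        refine ⟨fun h4 => ?_, ?_⟩
        · rw [h4, sub_self] at hval
          rcases mul_eq_zero.1 hval.symm with h5 | h5
          · exact ht0 h5
          · linarith
        · rw [← sub_pos, hval, mul_pos_iff_of_pos_right (sub_pos.2 hw)]
          simp
      · have := (h3 j hj).2 h
        refine ⟨this.ne', iff_of_false this.not_gt ?_⟩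
        rintro (h4 | ⟨rfl, -⟩)
        · rw [hu.2] at h; exact h4.not_gt h
        · exact h.ne hu.2
    refine ⟨L.add_mem hu.1 (L.smul_mem t hwL),
      regular_succ_iff.2 ⟨h1, fun j hj => (hcmp j hj).1⟩, h2, ?_⟩
    rw [position]
    exact congrArg _ (filter_congr fun j hj => (hcmp j hj).2)
  constructor
  · obtain ⟨h1, h2, h3, h4⟩ := main (-(δ / 2)) (by linarith)
      (by rw [Real.dist_eq, sub_zero, abs_neg, abs_of_pos] <;> linarith)
    refine mem_positions.2 ⟨_, h1, h2, h3, ?_⟩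
    rw [h4, orderRank_orderType hi]
    refine congrArg _ (filter_congr fun j _ => ?_)
    simp [(half_pos hδ).not_gt]
  · obtain ⟨h1, h2, h3, h4⟩ := main (δ / 2) (by linarith)
      (by rw [Real.dist_eq, sub_zero, abs_of_pos] <;> linarith)
    refine mem_positions.2 ⟨_, h1, h2, h3, ?_⟩
    rw [h4, orderRank_orderType hi, ← card_insert_of_notMem (a := i) (by simp)]
    congr 1
    ext j
    simp only [mem_filter, mem_insert, half_pos hδ, and_true]
    constructor
    · rintro ⟨hj, h | h⟩
      · exact Or.inr ⟨hj, h⟩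
      · exact Or.inl h
    · rintro (rfl | ⟨hj, h⟩)
      · exact ⟨hi, Or.inr rfl⟩
      · exact ⟨hj, Or.inl h⟩

/-- Between two positions occurring over a region, the region meets every wall. -/
theorem exists_wall_of_positions {p q s : ℕ} (hp : p ∈ positions y k L r)
    (hq : q ∈ positions y k L r) (hps : p ≤ s) (hsq : s < q) :
    ∃ i ∈ signedIndices k, r ∈ regions y k (wall y k L i) ∧ orderRank k r i = s := by
  obtain ⟨u₁, hL₁, hr₁, ho₁, hp₁⟩ := mem_positions.1 hp
  obtain ⟨u₂, hL₂, hr₂, ho₂, hp₂⟩ := mem_positions.1 hq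
  have hk₁ := (regular_succ_iff.1 hr₁).1
  -- The wall is that of the index of rank `s`: from p ≤ s < q, the new value lies below it at `u₁`
  -- and above it at `u₂`.
  obtain ⟨i, hi, his⟩ := exists_orderRank_eq hk₁
    (show s < 2 * k + 1 by have := position_le (y := y) (k := k) (u := u₂); lia)
  have h₁ : signedForm y (k + 1) u₁ < signedForm y i u₁ := by
    refine lt_of_le_of_ne (not_lt.1 fun h => ?_) ((regular_succ_iff.1 hr₁).2 i hi).symm
    have := orderRank_lt_position hi h
    lia
  have h₂ : signedForm y i u₂ < signedForm y (k + 1) u₂ := by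
    rw [← orderRank_lt_position_iff hi, ho₂, ← ho₁]
    lia
  have hsame := orderType_eq_iff.1 (ho₁.trans ho₂.symm)
  -- With these weights the difference of the forms k + 1 and `i` cancels at `β • u₁ + α • u₂`.
  -- Positive combinations stay in the region, which is a convex cone.
  set α := signedForm y i u₁ - signedForm y (k + 1) u₁ with hα
  set β := signedForm y (k + 1) u₂ - signedForm y i u₂ with hβ
  have hα0 : 0 < α := sub_pos.2 h₁
  have hβ0 : 0 < β := sub_pos.2 h₂
  have hval : ∀ j, signedForm y j (β • u₁ + α • u₂) =
      β * signedForm y j u₁ + α * signedForm y j u₂ := by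
    intro j; simp
  have hlt : ∀ a ∈ signedIndices k, ∀ b ∈ signedIndices k,
      signedForm y a u₁ < signedForm y b u₁ →
      signedForm y a (β • u₁ + α • u₂) < signedForm y b (β • u₁ + α • u₂) := by
    intro a ha b hb hab
    rw [hval, hval]
    exact add_lt_add (mul_lt_mul_of_pos_left hab hβ0)
      (mul_lt_mul_of_pos_left ((hsame a ha b hb).1 hab) hα0)
  refine ⟨i, hi, mem_regions.2 ⟨β • u₁ + α • u₂, ?_, ?_, ?_⟩, ho₁ ▸ his⟩
  · refine mem_wall.2 ⟨L.add_mem (L.smul_mem _ hL₁) (L.smul_mem _ hL₂), ?_⟩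
    rw [hval, hval, hα, hβ]; ring
  · intro a ha b hb hab
    rcases lt_trichotomy (signedForm y a u₁) (signedForm y b u₁) with h | h | h
    · exact absurd hab (hlt a ha b hb h).ne
    · exact hk₁ a ha b hb h
    · exact absurd hab (hlt b hb a ha h).ne'
  · rw [← ho₁]
    refine orderType_eq_iff.2 fun a ha b hb => ⟨fun hab => ?_, hlt a ha b hb⟩
    rcases lt_trichotomy (signedForm y a u₁) (signedForm y b u₁) with h | h | h
    · exact h
    · rw [hk₁ a ha b hb h] at hab; exact absurd hab (lt_irrefl _)
    · exact absurd hab (hlt b hb a ha h).le.not_gt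

open Classical in
-- The positions form an interval of integers. A wall whose index has rank s separates positions s
-- and s + 1, so all positions but the largest correspond to the walls met by the region.
theorem card_positions
    (hL : ∀ i ∈ signedIndices k, ∃ w ∈ L, signedForm y (k + 1) w ≠ signedForm y i w)
    (hr : r ∈ regions y k L) :
    #(positions y k L r) =
      #((signedIndices k).filter fun i => r ∈ regions y k (wall y k L i)) + 1 := by
  have hne : (positions y k L r).Nonempty := by
    obtain ⟨u, hu, hreg, rfl⟩ := mem_regions.1 hr
    by_cases h : Regular y (k + 1) u
    · exact ⟨_, mem_positions.2 ⟨u, hu, h, rfl, rfl⟩⟩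
    · rw [regular_succ_iff] at h
      push Not at h
      obtain ⟨j, hj, hjk⟩ := h hreg
      exact ⟨_, (orderRank_mem_positions hj (hL j hj)
        (mem_regions.2 ⟨u, mem_wall.2 ⟨hu, hjk.symm⟩, hreg, rfl⟩)).1⟩
  have hinj : Set.InjOn (orderRank k r)
      ((signedIndices k).filter fun i => r ∈ regions y k (wall y k L i)) := by
    obtain ⟨u, -, hreg, rfl⟩ := mem_regions.1 hr
    exact (orderRank_injOn hreg).mono fun i hi => (mem_filter.1 hi).1
  rw [← card_image_of_injOn hinj, ← card_erase_add_one (max'_mem _ hne)]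
  congr 2
  ext s
  simp only [mem_erase, mem_image, mem_filter]
  constructor
  · rintro ⟨hs1, hs2⟩
    obtain ⟨i, hi, h1, h2⟩ := exists_wall_of_positions hs2 (max'_mem _ hne) le_rfl
      (lt_of_le_of_ne (le_max' _ _ hs2) hs1)
    exact ⟨i, ⟨hi, h1⟩, h2⟩
  · rintro ⟨i, ⟨hi, h1⟩, rfl⟩
    obtain ⟨h2, h3⟩ := orderRank_mem_positions hi (hL i hi) h1
    refine ⟨fun h => ?_, h2⟩
    have := le_max' _ _ h3
    lia

/-- The order type up to `k + 1` is determined by the order type up to `k` and the position. -/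
theorem orderType_succ_eq (hu : Regular y (k + 1) u) (hw : Regular y (k + 1) w)
    (ho : orderType y k u = orderType y k w) (hp : position y k u = position y k w) :
    orderType y (k + 1) u = orderType y (k + 1) w := by
  have h1 := orderType_eq_iff.1 ho
  have h2 : ∀ i ∈ signedIndices k, (signedForm y i u < signedForm y (k + 1) u ↔
      signedForm y i w < signedForm y (k + 1) w) := by
    intro i hi
    rw [← orderRank_lt_position_iff hi, ← orderRank_lt_position_iff hi, ho, hp]
  have h3 : ∀ i ∈ signedIndices k, (signedForm y (k + 1) u < signedForm y i u ↔
      signedForm y (k + 1) w < signedForm y i w) := by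
    intro i hi
    have a := (regular_succ_iff.1 hu).2 i hi
    have b := (regular_succ_iff.1 hw).2 i hi
    have := h2 i hi
    rw [← not_le, ← not_le, a.le_iff_lt, b.le_iff_lt, this]
  have h4 := h2 0 (zero_mem_signedIndices k)
  have h5 := h3 0 (zero_mem_signedIndices k)
  simp only [signedForm_zero, LinearMap.zero_apply] at h4 h5
  refine orderType_eq_iff.2 fun i hi j hj => ?_
  rw [mem_signedIndices_succ] at hi hj
  rcases hi with hi | rfl | rfl <;> rcases hj with hj | rfl | rfl
  · exact h1 i hi j hj
  · exact h2 i hi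
  · have := h3 (-i) (neg_mem_signedIndices hi)
    simp only [signedForm_neg] at this ⊢
    rw [lt_neg, this, lt_neg]
  · exact h3 j hj
  · simp
  · simp only [signedForm_neg, lt_neg_self_iff, h5]
  · have := h2 (-j) (neg_mem_signedIndices hj)
    simp only [signedForm_neg] at this ⊢
    rw [neg_lt, this, neg_lt]
  · simp only [signedForm_neg, neg_lt_self_iff, h4]
  · simp

/-- Restrict order types to the indices up to k. The fibre over a region is its set of positions,
and exchanging the sum over regions with the sum over walls counts, for each wall, the regions it
meets. -/
theorem card_regions_succ
    (hL : ∀ i ∈ signedIndices k, ∃ w ∈ L, signedForm y (k + 1) w ≠ signedForm y i w) :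
    #(regions y (k + 1) L) =
      #(regions y k L) + ∑ i ∈ signedIndices k, #(regions y k (wall y k L i)) := by
  classical
  let res : Finset (ℤ × ℤ) → Finset (ℤ × ℤ) := fun r =>
    r.filter fun p => p.1 ∈ signedIndices k ∧ p.2 ∈ signedIndices k
  have hres : ∀ u, res (orderType y (k + 1) u) = orderType y k u := by
    intro u
    ext ⟨i, j⟩
    simp only [res, mem_filter, mem_orderType]
    constructor
    · rintro ⟨⟨-, h⟩, h'⟩; exact ⟨h', h⟩
    · rintro ⟨h', h⟩
      exact ⟨⟨⟨signedIndices_subset_succ k h'.1, signedIndices_subset_succ k h'.2⟩, h⟩, h'⟩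
  have hmaps : ∀ r ∈ regions y (k + 1) L, res r ∈ regions y k L := by
    intro r hr
    obtain ⟨u, hu, hreg, rfl⟩ := mem_regions.1 hr
    rw [hres]
    exact mem_regions.2 ⟨u, hu, (regular_succ_iff.1 hreg).1, rfl⟩
  have hfib : ∀ r ∈ regions y k L,
      #((regions y (k + 1) L).filter fun r' => res r' = r) = #(positions y k L r) := by
    intro r _
    have hpos : ∀ u, #((signedIndices k).filter fun j =>
        (j, (k + 1 : ℤ)) ∈ orderType y (k + 1) u) = position y k u := by
      intro u
      rw [position]
      refine congrArg _ (filter_congr fun j hj => ?_)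
      simp [mem_orderType, signedIndices_subset_succ k hj,
        mem_signedIndices_succ.2 (Or.inr (Or.inl rfl))]
    refine card_bij (fun r' _ => #((signedIndices k).filter fun j =>
        (j, (k + 1 : ℤ)) ∈ r')) ?_ ?_ ?_
    · intro r' hr'
      rw [mem_filter] at hr'
      obtain ⟨u, hu, hreg, rfl⟩ := mem_regions.1 hr'.1
      rw [hpos]
      exact mem_positions.2 ⟨u, hu, hreg, by rw [← hres, hr'.2], rfl⟩
    · intro r₁ hr₁ r₂ hr₂ h
      rw [mem_filter] at hr₁ hr₂
      obtain ⟨u₁, hu₁, hreg₁, rfl⟩ := mem_regions.1 hr₁.1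
      obtain ⟨u₂, hu₂, hreg₂, rfl⟩ := mem_regions.1 hr₂.1
      rw [hpos, hpos] at h
      rw [hres] at hr₁ hr₂
      exact orderType_succ_eq hreg₁ hreg₂ (hr₁.2.trans hr₂.2.symm) h
    · intro p hp
      obtain ⟨u, hu, hreg, ho, hpu⟩ := mem_positions.1 hp
      refine ⟨orderType y (k + 1) u, mem_filter.2 ⟨mem_regions.2 ⟨u, hu, hreg, rfl⟩, ?_⟩, ?_⟩
      · rw [hres, ho]
      · rw [hpos, hpu]
  rw [card_eq_sum_card_fiberwise hmaps, sum_congr rfl hfib,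
    sum_congr rfl fun r hr => card_positions hL hr, sum_add_distrib, add_comm]
  congr 1
  · simp
  · have := sum_card_bipartiteAbove_eq_sum_card_bipartiteBelow
      (s := regions y k L) (t := signedIndices k)
      (fun r i => r ∈ regions y k (wall y k L i))
    simp only [bipartiteAbove, bipartiteBelow] at this
    rw [this]
    refine sum_congr rfl fun i _ => ?_
    congr 1
    ext r
    rw [mem_filter]
    exact ⟨fun h => h.2, fun h => ⟨regions_mono inf_le_left h, h⟩⟩

theorem card_regions_zero : #(regions y 0 L) = 1 := by
  rw [card_eq_one]
  refine ⟨orderType y 0 0, ?_⟩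
  ext r
  rw [mem_regions, mem_singleton]
  have hi : ∀ i : ℤ, i ∈ signedIndices 0 → i = 0 := by
    intro i hi; rw [mem_signedIndices] at hi; lia
  constructor
  · rintro ⟨u, -, -, rfl⟩
    refine orderType_eq_iff.2 fun i hi' j hj => ?_
    rw [hi i hi', hi j hj]
    simp
  · rintro rfl
    exact ⟨0, L.zero_mem, fun i hi' j hj _ => (hi i hi').trans (hi j hj).symm, rfl⟩

/-- If the first `k` forms are independent on `L`, then every chamber meets `L`. -/
theorem card_regions_of_surjective (k : ℕ) (L : Submodule ℝ U)
    (hL : ∀ a : ℕ → ℝ, ∃ u ∈ L, ∀ j < k, y j u = a j) :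
    #(regions y k L) = 2 ^ k * k.factorial := by
  induction k generalizing L with
  | zero => simpa using card_regions_zero
  | succ k ih =>
    have hval : ∀ i ∈ signedIndices k, ∀ (a : ℕ → ℝ) (u : U), (∀ j < k, y j u = a j) →
        signedForm y i u = (i.sign : ℝ) * a (i.natAbs - 1) := by
      intro i hi a u h
      rcases eq_or_ne i 0 with rfl | h0
      · simp [signedForm]
      · rw [mem_signedIndices] at hi
        simp [signedForm, h (i.natAbs - 1) (by lia)]
    -- The new value can be placed at any offset `c` from that at `i`: c = 0 gives points on the
    -- wall with arbitrary earlier values, c = 1 a point of `L` off the wall.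
    have hext : ∀ i ∈ signedIndices k, ∀ (a : ℕ → ℝ) (c : ℝ), ∃ u ∈ L,
        (∀ j < k, y j u = a j) ∧
          signedForm y (k + 1) u = signedForm y i u + c := by
      intro i hi a c
      obtain ⟨u, hu, h⟩ := hL (fun j => if j < k then a j else
        (i.sign : ℝ) * a (i.natAbs - 1) + c)
      have h1 : ∀ j < k, y j u = a j := fun j hj => by
        rw [h j (by lia), if_pos hj]
      refine ⟨u, hu, h1, ?_⟩
      rw [signedForm_succ, h k (by lia), if_neg (lt_irrefl _), hval i hi a u h1]
    rw [card_regions_succ, ih L, sum_congr rfl fun i hi => ih (wall y k L i) ?_, sum_const,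
      card_signedIndices, Nat.factorial_succ, pow_succ, smul_eq_mul]
    · ring
    · intro a
      obtain ⟨u, hu, h1, h2⟩ := hext i hi a 0
      exact ⟨u, mem_wall.2 ⟨hu, by simpa using h2⟩, h1⟩
    · intro a
      obtain ⟨u, hu, h⟩ := hL a
      exact ⟨u, hu, fun j hj => h j (by lia)⟩
    · intro i hi
      obtain ⟨u, hu, h1, h2⟩ := hext i hi 0 1
      exact ⟨u, hu, by rw [h2]; simp⟩

/-- The number of distinct nonzero absolute values of the first `k` forms at `u`. -/
noncomputable def absCount (y : ℕ → U →ₗ[ℝ] ℝ) (k : ℕ) (u : U) : ℕ :=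
  #(((range k).image fun j => |y j u|).erase 0)

theorem absCount_le_of_subset {s : Finset ℕ} (h : ∀ j < k, j ∉ s → y j u = 0) :
    absCount y k u ≤ #s := by
  refine (card_le_card ?_).trans (card_image_le (s := s) (f := fun j => |y j u|))
  intro a ha
  simp only [mem_erase, mem_image, mem_range] at ha ⊢
  obtain ⟨ha0, j, hj, rfl⟩ := ha
  by_cases hjs : j ∈ s
  · exact ⟨j, hjs, rfl⟩
  · exact absurd (by simp [h j hj hjs]) ha0

theorem absCount_succ_le : absCount y (k + 1) u ≤ absCount y k u + 1 := by
  unfold absCount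
  refine (card_le_card (t := insert |y k u| (((range k).image fun j => |y j u|).erase 0)) ?_).trans
    (card_insert_le _ _)
  intro a ha
  simp only [mem_erase, mem_image, mem_range, mem_insert] at ha ⊢
  obtain ⟨ha0, j, hj, rfl⟩ := ha
  rcases eq_or_lt_of_le (Nat.lt_succ_iff.1 hj) with rfl | hj
  · exact Or.inl rfl
  · exact Or.inr ⟨ha0, j, hj, rfl⟩

/-- On a wall the last form vanishes or repeats an earlier absolute value, so genericity passes to
the wall with one form fewer. -/
theorem absCount_succ_of_eq {i : ℤ} (hi : i ∈ signedIndices k)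
    (h : signedForm y (k + 1) u = signedForm y i u) :
    absCount y (k + 1) u ≤ absCount y k u := by
  refine card_le_card fun a ha => ?_
  simp only [mem_erase, mem_image, mem_range] at ha ⊢
  obtain ⟨ha0, j, hj, rfl⟩ := ha
  refine ⟨ha0, ?_⟩
  rcases eq_or_lt_of_le (Nat.lt_succ_iff.1 hj) with rfl | hj
  · rw [signedForm_succ] at h
    rw [mem_signedIndices] at hi
    rcases eq_or_ne i 0 with rfl | h0
    · simp [h, signedForm_zero] at ha0
    · refine ⟨i.natAbs - 1, by lia, ?_⟩
      rw [h, signedForm, LinearMap.smul_apply, smul_eq_mul, abs_mul]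
      rcases lt_or_gt_of_ne h0 with h0 | h0
      · simp [Int.sign_eq_neg_one_of_neg h0]
      · simp [Int.sign_eq_one_of_pos h0]
  · exact ⟨j, hj, rfl⟩

/-- If every nonzero vector of `L` has more than `d` distinct nonzero absolute values, then the
dimension of `L` is at most `k - d`. -/
theorem finrank_le_of_lt_absCount {d : ℕ} (hd : d ≤ k)
    (hL : ∀ u ∈ L, u ≠ 0 → d < absCount y k u) : Module.finrank ℝ L ≤ k - d := by
  -- Forgetting the first `d` forms is injective on `L`: a vector killed by the others has at most
  -- `d` nonzero absolute values.
  let φ : L →ₗ[ℝ] (Fin (k - d) → ℝ) := LinearMap.pi fun l => (y (d + l)).comp L.subtype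
  have hφ : Function.Injective φ := by
    rw [← LinearMap.ker_eq_bot, LinearMap.ker_eq_bot']
    rintro ⟨u, hu⟩ h
    by_contra h0
    refine absurd (hL u hu fun h => h0 (by simp [h])) (not_lt.2 ?_)
    refine (absCount_le_of_subset (s := range d) fun j hj hjd => ?_).trans (card_range d).le
    rw [mem_range, not_lt] at hjd
    have := congrFun h ⟨j - d, by lia⟩
    simpa [φ, Nat.add_sub_cancel' hjd] using this
  simpa using LinearMap.finrank_le_finrank_of_injective hφ

/-- The number of regions cut out in a generic subspace of codimension `d` of `ℝᵏ` by the
reflection arrangement of type `B`. -/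
theorem card_regions_add [FiniteDimensional ℝ U] {d : ℕ} (hk : 1 ≤ k) (hd : d ≤ k)
    (hdim : Module.finrank ℝ L + d = k) (hL : ∀ u ∈ L, u ≠ 0 → d < absCount y k u) :
    #(regions y k L) + 2 * sumB k d = 2 ^ k * k.factorial := by
  induction k generalizing d L with
  | zero => lia
  | succ k ih =>
    rcases eq_or_lt_of_le hd with rfl | hdk
    -- Codimension k + 1 forces L = 0, which contains no regular vector.
    · rw [two_mul_sumB_of_le hk le_rfl, Nat.add_eq_right, card_eq_zero,
        eq_empty_iff_forall_notMem]
      intro r hr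
      obtain ⟨u, hu, hreg, -⟩ := mem_regions.1 hr
      have h0 : L = ⊥ := Submodule.finrank_eq_zero.1 (by lia)
      rw [h0, Submodule.mem_bot] at hu
      subst hu
      have := hreg 0 (zero_mem_signedIndices _) (k + 1)
        (mem_signedIndices_succ.2 (Or.inr (Or.inl rfl))) (by simp)
      lia
    -- In codimension 0, genericity makes the k + 1 forms jointly injective on `L`; by dimension
    -- they are bijective, and every chamber is met.
    rcases Nat.eq_zero_or_pos d with rfl | hd0
    · rw [sumB_zero, mul_zero, add_zero]
      refine card_regions_of_surjective _ _ fun a => ?_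
      let φ : L →ₗ[ℝ] (Fin (k + 1) → ℝ) := LinearMap.pi fun l => (y l).comp L.subtype
      have hφ : Function.Injective φ := by
        rw [← LinearMap.ker_eq_bot, LinearMap.ker_eq_bot']
        rintro ⟨u, hu⟩ h
        by_contra h0
        refine absurd (hL u hu fun h => h0 (by simp [h])) (not_lt.2 ?_)
        refine (absCount_le_of_subset (s := ∅) fun j hj _ => ?_).trans (by simp)
        simpa [φ] using congrFun h ⟨j, hj⟩
      have hs := (LinearMap.injective_iff_surjective_of_finrank_eq_finrank
        (f := φ) (by simpa using hdim)).1 hφ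
      obtain ⟨u, hu⟩ := hs fun l => a l
      exact ⟨u, u.2, fun j hj => by simpa [φ] using congrFun hu ⟨j, hj⟩⟩
    obtain ⟨d, rfl⟩ : ∃ e, d = e + 1 := ⟨d - 1, by lia⟩
    have hgen : ∀ i ∈ signedIndices k, ∀ u ∈ wall y k L i, u ≠ 0 → d + 1 < absCount y k u := by
      intro i hi u hu h0
      rw [mem_wall] at hu
      exact (hL u hu.1 h0).trans_le (absCount_succ_of_eq hi hu.2)
    have hle : ∀ i ∈ signedIndices k, Module.finrank ℝ (wall y k L i) ≤ k - (d + 1) :=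
      fun i hi => finrank_le_of_lt_absCount (by lia) (hgen i hi)
    have hne : ∀ i ∈ signedIndices k,
        ∃ w ∈ L, signedForm y (k + 1) w ≠ signedForm y i w := by
      intro i hi
      by_contra! h
      have : wall y k L i = L := by
        ext u
        rw [mem_wall]
        exact ⟨fun h' => h'.1, fun hu => ⟨hu, h u hu⟩⟩
      have h1 := hle i hi
      rw [this] at h1
      lia
    -- Genericity bounds the dimension of the wall above; cutting with the kernel of one form lowers
    -- the dimension by at most one.
    have hrank : ∀ i ∈ signedIndices k, Module.finrank ℝ (wall y k L i) + (d + 1) = k := by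
      intro i hi
      have h1 := hle i hi
      have h2 := Submodule.finrank_sup_add_finrank_inf_eq L
        (LinearMap.ker (signedForm y (k + 1) - signedForm y i))
      have h3 := (signedForm y (k + 1) - signedForm y i).finrank_range_add_finrank_ker
      have h4 := Submodule.finrank_le
        (L ⊔ LinearMap.ker (signedForm y (k + 1) - signedForm y i))
      have h5 := Submodule.finrank_le
        (LinearMap.range (signedForm y (k + 1) - signedForm y i))
      rw [Module.finrank_self] at h5
      change _ + Module.finrank ℝ (wall y k L i) = _ at h2
      lia
    -- Seen through the first `k` forms only, `L` has codimension one less, and dropping a form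
    -- loses at most one absolute value.
    have h1 := ih (L := L) (d := d) (by lia) (by lia) (by lia) fun u hu h0 => by
      have := hL u hu h0
      have := absCount_succ_le (y := y) (k := k) (u := u)
      lia
    have h2 : ∀ i ∈ signedIndices k,
        #(regions y k (wall y k L i)) + 2 * sumB k (d + 1) = 2 ^ k * k.factorial :=
      fun i hi => ih (by lia) (by lia) (hrank i hi) (hgen i hi)
    have h3 := sum_congr rfl h2
    rw [sum_add_distrib, sum_const, sum_const, card_signedIndices, smul_eq_mul,
      smul_eq_mul] at h3
    rw [card_regions_succ hne, sumB_succ_succ, Nat.factorial_succ, pow_succ]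
    linear_combination h1 + h3

end Regions

/-! ### Abel summation and genericity of increments. -/

section Generic

/-- The number of distinct nonzero absolute values of the entries of a vector. -/
noncomputable def absCard {n : ℕ} (z : Fin n → ℝ) : ℕ :=
  #((univ.image fun j => |z j|).erase 0)

theorem absCard_le {n : ℕ} (z : Fin n → ℝ) : absCard z ≤ n :=
  (card_le_card (erase_subset _ _)).trans (card_image_le.trans (by simp))

theorem absCard_le_of_forall_exists {m n : ℕ} {z : Fin m → ℝ} {z' : Fin n → ℝ}
    (h : ∀ j, z j ≠ 0 → ∃ i, |z j| = |z' i|) : absCard z ≤ absCard z' := by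
  refine card_le_card fun a ha => ?_
  simp only [mem_erase, mem_image, mem_univ, true_and] at ha ⊢
  obtain ⟨h0, j, rfl⟩ := ha
  obtain ⟨i, hi⟩ := h j (by simpa using h0)
  exact ⟨h0, i, hi.symm⟩

variable {V : Type*} [AddCommGroup V] [Module ℝ V]

/-- Vectors are generic (with respect to `d`) when the coefficients of every nontrivial linear
relation between them have more than `d` distinct nonzero absolute values. -/
def Generic (d : ℕ) {n : ℕ} (η : Fin n → V) : Prop :=
  ∀ z : Fin n → ℝ, ∑ j, z j • η j = 0 → z ≠ 0 → d < absCard z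

variable {d k n : ℕ} {η : Fin k → V}

theorem Generic.signed_perm (h : Generic d η) (τ : Equiv.Perm (Fin k)) (ε : Fin k → ℤˣ) :
    Generic d fun l => ((ε (τ l) : ℤ) : ℝ) • η (τ l) := by
  have habs : ∀ e : ℤˣ, |((e : ℤ) : ℝ)| = 1 := fun e => by
    rcases Int.units_eq_one_or e with rfl | rfl <;> simp
  intro z hz h0
  have hsum : ∑ j, (((ε j : ℤ) : ℝ) * z (τ.symm j)) • η j = 0 := by
    rw [← hz, ← Equiv.sum_comp τ]
    refine sum_congr rfl fun l _ => ?_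
    rw [smul_smul, Equiv.symm_apply_apply, mul_comm]
  refine (h _ hsum fun h1 => h0 (funext fun l => ?_)).trans_le
    (absCard_le_of_forall_exists fun j _ => ⟨τ.symm j, by rw [abs_mul, habs, one_mul]⟩)
  have h2 := congrFun h1 (τ l)
  simp only [Equiv.symm_apply_apply, Pi.zero_apply, mul_eq_zero] at h2
  rcases h2 with h2 | h2
  · have := habs (ε (τ l)); rw [h2] at this; simp at this
  · exact h2

/-- The sums of the tails of a vector. -/
def tailSum (c : Fin k → ℝ) (j : Fin k) : ℝ := ∑ i ∈ Ici j, c i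

/-- Abel summation: increment j enters the walk at every time i ≥ j. -/
theorem sum_smul_walk (c : Fin k → ℝ) (η : Fin k → V) :
    ∑ i, c i • walk η i = ∑ j, tailSum c j • η j := by
  simp only [walk, tailSum, smul_sum, sum_smul]
  rw [sum_comm' (t' := univ) (s' := fun j => Ici j)]
  simp

/-- The decrements of a vector, with the last entry followed by zero. -/
noncomputable def decrement (z : Fin k → ℝ) (i : Fin k) : ℝ :=
  z i - if h : (i : ℕ) + 1 < k then z ⟨i + 1, h⟩ else 0

theorem tailSum_decrement (z : Fin k → ℝ) : tailSum (decrement z) = z := by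
  let zz : ℕ → ℝ := fun m => if h : m < k then z ⟨m, h⟩ else 0
  funext j
  have h1 : tailSum (decrement z) j = ∑ m ∈ Ico (j : ℕ) k, (zz m - zz (m + 1)) := by
    rw [tailSum, ← Fin.map_valEmbedding_Ici, sum_map]
    exact sum_congr rfl fun i _ => by simp [zz, decrement]
  have h2 := sum_Ico_sub zz j.2.le
  rw [h1, ← neg_inj, ← sum_neg_distrib]
  simp only [neg_sub]
  rw [h2]
  simp [zz]

theorem decrement_pos {z : Fin k → ℝ} (hz : StrictAnti z) (h0 : ∀ i, 0 < z i) (i : Fin k) :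
    0 < decrement z i := by
  rw [decrement, sub_pos]
  split_ifs with h
  · exact hz (Fin.mk_lt_mk.2 (Nat.lt_succ_self _))
  · exact h0 i

/-- A nonzero decrement marks the end of a run of equal values, so the marked indices carry distinct
values. -/
theorem lt_of_decrement_ne_zero {z : Fin k → ℝ} (hz : Antitone z) {i j : Fin k}
    (hi : decrement z i ≠ 0) (hij : i < j) : z j < z i := by
  have hlt : (i : ℕ) + 1 < k := lt_of_le_of_lt (Nat.succ_le_of_lt hij) j.2
  rw [decrement, dif_pos hlt] at hi
  have h1 : z ⟨i + 1, hlt⟩ ≤ z i := hz (Fin.mk_le_mk.2 (Nat.le_succ _))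
  have h2 : z j ≤ z ⟨i + 1, hlt⟩ := hz (Fin.mk_le_mk.2 (Nat.succ_le_of_lt hij))
  exact h2.trans_lt (lt_of_le_of_ne h1 fun h => hi (by rw [h, sub_self]))

theorem ne_zero_of_decrement_ne_zero {z : Fin k → ℝ} (hz : Antitone z) (h0 : ∀ i, 0 ≤ z i)
    {i : Fin k} (hi : decrement z i ≠ 0) : z i ≠ 0 := by
  intro h
  refine hi ?_
  rw [decrement, h, zero_sub, neg_eq_zero]
  split_ifs with hlt
  · exact le_antisymm (h ▸ hz (Fin.mk_le_mk.2 (Nat.le_succ _))) (h0 _)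
  · rfl

theorem tailSum_strictAnti {c : Fin k → ℝ} (hc : ∀ i, 0 < c i) : StrictAnti (tailSum c) := by
  intro i j hij
  refine sum_lt_sum_of_subset (i := i) (Ici_subset_Ici.2 hij.le) (by simp) (by simpa using hij)
    (hc i) fun l _ _ => (hc l).le

theorem tailSum_pos {c : Fin k → ℝ} (hc : ∀ i, 0 < c i) (j : Fin k) : 0 < tailSum c j :=
  sum_pos (fun i _ => hc i) ⟨j, by simp⟩

theorem eq_zero_of_tailSum_eq_zero {c : Fin k → ℝ} (h : tailSum c = 0) : c = 0 := by
  by_contra hne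
  obtain ⟨i₀, hi₀⟩ := Function.ne_iff.1 hne
  have hn : (univ.filter fun i => c i ≠ 0).Nonempty := ⟨i₀, by simpa using hi₀⟩
  have hm := max'_mem _ hn
  set i := max' _ hn with hi
  rw [mem_filter] at hm
  refine hm.2 ?_
  have h1 : tailSum c i = 0 := congrFun h i
  rw [← h1, tailSum, sum_eq_single i]
  · intro j hj hji
    by_contra hcj
    exact hji (le_antisymm (le_max' _ j (by simpa using hcj)) (mem_Ici.1 hj))
  · simp

/-- A tail sum from j equals the one from the first support index at or after j, and is zero if
there is none. -/
theorem absCard_tailSum_le (c : Fin k → ℝ) :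
    absCard (tailSum c) ≤ #(univ.filter fun i => c i ≠ 0) := by
  refine (card_le_card ?_).trans (card_image_le (f := fun i => |tailSum c i|))
  intro a ha
  simp only [mem_erase, mem_image, mem_univ, true_and, mem_filter] at ha ⊢
  obtain ⟨h0, j, rfl⟩ := ha
  have hne : ((Ici j).filter fun i => c i ≠ 0).Nonempty := by
    by_contra h
    rw [not_nonempty_iff_eq_empty, filter_eq_empty_iff] at h
    refine h0 ?_
    rw [abs_eq_zero]
    exact sum_eq_zero fun i hi => not_not.1 (h hi)
  have hm := min'_mem _ hne
  set i := min' _ hne with hi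
  rw [mem_filter, mem_Ici] at hm
  refine ⟨i, hm.2, congrArg _ ?_⟩
  refine sum_subset (Ici_subset_Ici.2 hm.1) fun l hl hl' => ?_
  by_contra hcl
  exact hl' (mem_Ici.2 (min'_le _ _ (mem_filter.2 ⟨hl, hcl⟩)))

/-- In particular any `d` positions of a generic walk are linearly independent. -/
theorem Generic.lt_card_support (h : Generic d η) {c : Fin k → ℝ}
    (hc : ∑ i, c i • walk η i = 0) (h0 : c ≠ 0) : d < #(univ.filter fun i => c i ≠ 0) := by
  rw [sum_smul_walk] at hc
  exact (h _ hc fun h1 => h0 (eq_zero_of_tailSum_eq_zero h1)).trans_le (absCard_tailSum_le c)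

theorem zero_mem_convexHull_range_iff {ι : Type*} [Fintype ι] (x : ι → V) :
    (0 : V) ∈ convexHull ℝ (Set.range x) ↔
      ∃ c ∈ stdSimplex ℝ ι, ∑ i, c i • x i = 0 := by
  classical
  have hx : Set.range x =
      Fintype.linearCombination ℝ x '' Set.range fun i : ι => Pi.single i (1 : ℝ) := by
    rw [← Set.range_comp]
    congr 1
    funext i
    simp [Fintype.linearCombination_apply_single]
  rw [hx, ← LinearMap.image_convexHull, convexHull_rangle_single_eq_stdSimplex]
  simp [Fintype.linearCombination_apply]

/-- Abel summation matches strictly positive weights with strictly decreasing positive coefficients.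
What remains is to remove zero weights from a convex combination: the positions of nonzero weight
contain a basis, which can compensate small positive weights on the others. -/
theorem Generic.zero_mem_convexHull_walk_iff [FiniteDimensional ℝ V] (hk : 1 ≤ k)
    (hd : Module.finrank ℝ V = d) (h : Generic d η) :
    (0 : V) ∈ convexHull ℝ (Set.range (walk η)) ↔
      ∃ z : Fin k → ℝ, ∑ j, z j • η j = 0 ∧ StrictAnti z ∧ ∀ i, 0 < z i := by
  rw [zero_mem_convexHull_range_iff]
  constructor
  · rintro ⟨c, ⟨hc0, hc1⟩, hc⟩
    have hne : c ≠ 0 := by rintro rfl; simp at hc1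
    have hcard := h.lt_card_support hc hne
    obtain ⟨P, hPsub, hP⟩ := exists_subset_card_eq hcard.le
    have hli : LinearIndependent ℝ fun i : P => walk η i := by
      rw [Fintype.linearIndependent_iff]
      intro f hf
      let f' : Fin k → ℝ := fun i => if hi : i ∈ P then f ⟨i, hi⟩ else 0
      have hf' : ∑ i, f' i • walk η i = 0 := by
        rw [← hf, ← sum_subset (subset_univ P) fun i _ hi => by simp [f', hi], ← sum_coe_sort P]
        exact sum_congr rfl fun i _ => by simp [f']
      by_contra! hne
      obtain ⟨i, hi⟩ := hne
      have h1 := h.lt_card_support hf' fun h0 => hi (by simpa [f'] using congrFun h0 i)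
      refine absurd (h1.trans_le (card_le_card (t := P) fun j hj => ?_)) (by simp [hP])
      rw [mem_filter] at hj
      by_contra hjP
      exact hj.2 (by simp [f', hjP])
    have hspan : Submodule.span ℝ (Set.range fun i : P => walk η i) = ⊤ :=
      hli.span_eq_top_of_card_eq_finrank' (by simp [hP, hd])
    obtain ⟨b, hb⟩ := (Submodule.mem_span_range_iff_exists_fun ℝ).1
      (hspan ▸ Submodule.mem_top : -∑ i ∈ univ.filter (fun i => c i = 0), walk η i ∈ _)
    -- A relation with coefficient 1 wherever `c` vanishes, corrected on the basis `P`. As `P` lies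
    -- in the support of `c`, a small positive multiple of `e` makes all weights positive.
    let e : Fin k → ℝ := fun i =>
      (if c i = 0 then 1 else 0) + if hi : i ∈ P then b ⟨i, hi⟩ else 0
    have he : ∑ i, e i • walk η i = 0 := by
      have h1 : ∑ i, (if hi : i ∈ P then b ⟨i, hi⟩ else 0) • walk η i =
          ∑ i : P, b i • walk η i := by
        rw [← sum_subset (subset_univ P) fun i _ hi => by simp [hi], ← sum_coe_sort P]
        exact sum_congr rfl fun i _ => by simp
      simp only [e, add_smul, sum_add_distrib, h1, hb, ite_smul, one_smul, zero_smul]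
      rw [← sum_filter, add_neg_cancel]
    have hpos : ∃ t : ℝ, ∀ i, 0 < c i + t * e i := by
      have : ∀ᶠ t : ℝ in nhdsWithin 0 (Set.Ioi 0), ∀ i, 0 < c i + t * e i := by
        rw [Filter.eventually_all]
        intro i
        rcases (hc0 i).eq_or_lt with hi | hi
        · have hiP : i ∉ P := fun hiP => by
            have := hPsub hiP
            rw [mem_filter] at this
            exact this.2 hi.symm
          filter_upwards [self_mem_nhdsWithin] with t ht
          simpa [e, ← hi, hiP] using ht
        · refine Filter.Eventually.filter_mono nhdsWithin_le_nhds ?_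
          have hcont : Continuous fun t : ℝ => c i + t * e i := by fun_prop
          exact continuousAt_const.eventually_lt hcont.continuousAt (by simpa using hi)
      exact this.exists
    obtain ⟨t, ht⟩ := hpos
    refine ⟨tailSum fun i => c i + t * e i, ?_, tailSum_strictAnti ht, tailSum_pos ht⟩
    rw [← sum_smul_walk]
    simp only [add_smul, mul_smul, sum_add_distrib, hc, ← smul_sum, he, smul_zero, add_zero]
  · rintro ⟨z, hz, hanti, hpos⟩
    have hc := decrement_pos hanti hpos
    rw [← tailSum_decrement z, ← sum_smul_walk] at hz
    set c := decrement z
    have hs : 0 < ∑ i, c i := sum_pos (fun i _ => hc i) ⟨⟨0, hk⟩, mem_univ _⟩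
    refine ⟨fun i => (∑ i, c i)⁻¹ * c i, ⟨fun i => ?_, ?_⟩, ?_⟩
    · have := hc i; positivity
    · rw [← mul_sum, inv_mul_cancel₀ hs.ne']
    · simp only [mul_smul, ← smul_sum, hz, smul_zero]

end Generic

/-! ### Signed permutations as chambers of type B. -/

section Chambers

variable {k : ℕ}

/-- The coordinate forms on `Fin k → ℝ`, extended by zero. -/
noncomputable def coordForm (k : ℕ) (j : ℕ) : (Fin k → ℝ) →ₗ[ℝ] ℝ :=
  if h : j < k then LinearMap.proj ⟨j, h⟩ else 0

theorem coordForm_fin (j : Fin k) (z : Fin k → ℝ) : coordForm k j z = z j := by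
  simp [coordForm]

theorem absCount_coordForm (z : Fin k → ℝ) : absCount (coordForm k) k z = absCard z := by
  rw [absCount, absCard]
  congr 2
  ext a
  simp only [mem_image, mem_range, mem_univ, true_and]
  constructor
  · rintro ⟨j, hj, rfl⟩
    exact ⟨⟨j, hj⟩, by rw [← coordForm_fin ⟨j, hj⟩ z]⟩
  · rintro ⟨j, rfl⟩
    exact ⟨j, j.2, by rw [coordForm_fin]⟩

/-- The open chamber of the reflection group of type `B` attached to a signed permutation. -/
def InChamber (g : Equiv.Perm (Fin k) × (Fin k → ℤˣ)) (z : Fin k → ℝ) : Prop :=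
  (StrictAnti fun l => ((g.2 (g.1 l) : ℤ) : ℝ) * z (g.1 l)) ∧
    ∀ l, 0 < ((g.2 (g.1 l) : ℤ) : ℝ) * z (g.1 l)

/-- The signed index at the `l`-th place of a signed permutation. -/
def signedIndex (g : Equiv.Perm (Fin k) × (Fin k → ℤˣ)) (l : Fin k) : ℤ :=
  (g.2 (g.1 l) : ℤ) * ((g.1 l : ℕ) + 1)

variable {g g' : Equiv.Perm (Fin k) × (Fin k → ℤˣ)} {z z' : Fin k → ℝ}

theorem signedForm_signedIndex (g : Equiv.Perm (Fin k) × (Fin k → ℤˣ)) (l : Fin k)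
    (z : Fin k → ℝ) : signedForm (coordForm k) (signedIndex g l) z =
      ((g.2 (g.1 l) : ℤ) : ℝ) * z (g.1 l) := by
  rw [signedIndex]
  rcases Int.units_eq_one_or (g.2 (g.1 l)) with h | h
  · simp [h, signedForm_succ, coordForm_fin]
  · simp only [h, Units.val_neg, Units.val_one, neg_mul, one_mul, signedForm_neg, signedForm_succ,
      coordForm_fin, Int.cast_neg, Int.cast_one]

theorem signedIndex_mem (g : Equiv.Perm (Fin k) × (Fin k → ℤˣ)) (l : Fin k) :
    signedIndex g l ∈ signedIndices k := by
  rw [mem_signedIndices, signedIndex]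
  rcases Int.units_eq_one_or (g.2 (g.1 l)) with h | h <;> rw [h] <;> push_cast <;>
    have := (g.1 l).2 <;> lia

theorem exists_signedIndex (g : Equiv.Perm (Fin k) × (Fin k → ℤˣ)) {i : ℤ}
    (hi : i ∈ signedIndices k) :
    i = 0 ∨ ∃ l, i = signedIndex g l ∨ i = -signedIndex g l := by
  rcases eq_or_ne i 0 with h0 | h0
  · exact Or.inl h0
  rw [mem_signedIndices] at hi
  refine Or.inr ⟨g.1.symm ⟨i.natAbs - 1, by lia⟩, ?_⟩
  simp only [signedIndex, Equiv.apply_symm_apply]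
  rcases Int.units_eq_one_or (g.2 ⟨i.natAbs - 1, by lia⟩) with h | h <;> rw [h] <;>
    push_cast <;> lia

theorem inChamber_iff : InChamber g z ↔
    (StrictAnti fun l => signedForm (coordForm k) (signedIndex g l) z) ∧
      ∀ l, 0 < signedForm (coordForm k) (signedIndex g l) z := by
  simp only [signedForm_signedIndex, InChamber]

theorem InChamber.regular (h : InChamber g z) : Regular (coordForm k) k z := by
  obtain ⟨h1, h2⟩ := inChamber_iff.1 h
  intro i hi j hj hij
  rcases exists_signedIndex g hi with rfl | ⟨l, rfl | rfl⟩ <;>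
  rcases exists_signedIndex g hj with rfl | ⟨m, rfl | rfl⟩ <;>
  try simp only [signedForm_neg, signedForm_zero, LinearMap.zero_apply, neg_inj] at hij
  · rfl
  · have := h2 m; linarith
  · have := h2 m; linarith
  · have := h2 l; linarith
  · rw [h1.injective hij]
  · have := h2 l; have := h2 m; linarith
  · have := h2 l; linarith
  · have := h2 l; have := h2 m; linarith
  · rw [h1.injective hij]

theorem InChamber.orderType_eq (h : InChamber g z) (h' : InChamber g z') :
    orderType (coordForm k) k z = orderType (coordForm k) k z' := by
  obtain ⟨h1, h2⟩ := inChamber_iff.1 h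
  obtain ⟨h1', h2'⟩ := inChamber_iff.1 h'
  refine orderType_eq_iff.2 fun i hi j hj => ?_
  rcases exists_signedIndex g hi with rfl | ⟨l, rfl | rfl⟩ <;>
  rcases exists_signedIndex g hj with rfl | ⟨m, rfl | rfl⟩ <;>
  try simp only [signedForm_neg, signedForm_zero, LinearMap.zero_apply, neg_lt_neg_iff,
    lt_irrefl]
  · exact iff_of_true (h2 m) (h2' m)
  · have := h2 m; have := h2' m
    exact iff_of_false (by linarith) (by linarith)
  · exact iff_of_false (h2 l).not_gt (h2' l).not_gt
  · rw [h1.lt_iff_gt, h1'.lt_iff_gt]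
  · have := h2 l; have := h2' l; have := h2 m; have := h2' m
    exact iff_of_false (by linarith) (by linarith)
  · have := h2 l; have := h2' l
    exact iff_of_true (by linarith) (by linarith)
  · have := h2 l; have := h2' l; have := h2 m; have := h2' m
    exact iff_of_true (by linarith) (by linarith)
  · rw [h1.lt_iff_gt, h1'.lt_iff_gt]

theorem InChamber.of_orderType_eq (h : InChamber g z)
    (ho : orderType (coordForm k) k z = orderType (coordForm k) k z') : InChamber g z' := by
  rw [inChamber_iff] at h ⊢
  rw [orderType_eq_iff] at ho
  refine ⟨fun l m hlm => ?_, fun l => ?_⟩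
  · exact (ho _ (signedIndex_mem g m) _ (signedIndex_mem g l)).1 (h.1 hlm)
  · have := ho 0 (zero_mem_signedIndices k) _ (signedIndex_mem g l)
    simp only [signedForm_zero, LinearMap.zero_apply] at this
    exact this.1 (h.2 l)

/-- Regularity makes the absolute values of the coordinates distinct and nonzero: sort them in
decreasing order and record the signs. -/
theorem Regular.exists_inChamber (h : Regular (coordForm k) k z) : ∃ g, InChamber g z := by
  have hidx : ∀ j : Fin k, ((j : ℕ) + 1 : ℤ) ∈ signedIndices k := fun j => by
    rw [mem_signedIndices]; have := j.2; lia
  have hval : ∀ j : Fin k, signedForm (coordForm k) ((j : ℕ) + 1 : ℤ) z = z j := fun j => by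
    rw [signedForm_succ, coordForm_fin]
  have h0 : ∀ j, z j ≠ 0 := fun j hj => by
    have := h _ (hidx j) 0 (zero_mem_signedIndices k) (by rw [hval, hj]; simp [signedForm_zero])
    lia
  have hinj : Function.Injective fun j => -|z j| := by
    intro i j hij
    rcases abs_eq_abs.1 (neg_inj.1 hij) with h1 | h1
    · have := h _ (hidx i) _ (hidx j) (by rw [hval, hval, h1])
      exact Fin.ext (by lia)
    · have := h _ (hidx i) _ (neg_mem_signedIndices (hidx j))
        (by rw [signedForm_neg, hval, hval, h1])
      lia
  let ε : Fin k → ℤˣ := fun j => if 0 < z j then 1 else -1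
  have hε : ∀ j, ((ε j : ℤ) : ℝ) * z j = |z j| := by
    intro j
    simp only [ε]
    split_ifs with hj
    · simp [abs_of_pos hj]
    · simp [abs_of_nonpos (not_lt.1 hj)]
  refine ⟨(Tuple.sort fun j => -|z j|, ε), ?_, ?_⟩
  · have := (Tuple.monotone_sort fun j => -|z j|).strictMono_of_injective
      (hinj.comp (Equiv.injective _))
    intro l m hlm
    simp only [hε]
    exact neg_lt_neg_iff.1 (this hlm)
  · intro l
    simp only [hε]
    exact abs_pos.2 (h0 _)

theorem InChamber.unique (h : InChamber g z) (h' : InChamber g' z) : g = g' := by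
  have hsgn : g.2 = g'.2 := by
    funext j
    have h1 := h.2 (g.1.symm j)
    have h2 := h'.2 (g'.1.symm j)
    rw [Equiv.apply_symm_apply] at h1 h2
    rcases Int.units_eq_one_or (g.2 j) with e | e <;>
      rcases Int.units_eq_one_or (g'.2 j) with e' | e' <;> rw [e] at h1 ⊢ <;> rw [e'] at h2 ⊢ <;>
      push_cast at h1 h2 <;> linarith
  have h1 := h.1
  have h2 := h'.1
  rw [← hsgn] at h2
  have h3 := Tuple.unique_antitone (f := fun j => ((g.2 j : ℤ) : ℝ) * z j) h1.antitone h2.antitone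
  refine Prod.ext (Equiv.ext fun l => ?_) hsgn
  have hinj : Function.Injective fun j => ((g.2 j : ℤ) : ℝ) * z j := by
    have := h1.injective.comp g.1.symm.injective
    simpa [Function.comp_def] using this
  exact hinj (congrFun h3 l)

open Classical in
-- A chamber consists of all vectors of one regular order type, and distinct chambers are disjoint.
theorem card_inChamber (L : Submodule ℝ (Fin k → ℝ)) :
    #(univ.filter fun g : Equiv.Perm (Fin k) × (Fin k → ℤˣ) => ∃ z ∈ L, InChamber g z) =
      #(regions (coordForm k) k L) := by
  refine card_bij (fun g hg => orderType (coordForm k) k (mem_filter.1 hg).2.choose) ?_ ?_ ?_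
  · intro g hg
    have := (mem_filter.1 hg).2.choose_spec
    exact mem_regions.2 ⟨_, this.1, this.2.regular, rfl⟩
  · intro g hg g' hg' h
    have h1 := (mem_filter.1 hg).2.choose_spec
    have h2 := (mem_filter.1 hg').2.choose_spec
    exact (h1.2.of_orderType_eq h).unique h2.2
  · intro r hr
    obtain ⟨z, hz, hreg, rfl⟩ := mem_regions.1 hr
    obtain ⟨g, hg⟩ := hreg.exists_inChamber
    have hmem : g ∈ univ.filter fun g : Equiv.Perm (Fin k) × (Fin k → ℤˣ) =>
      ∃ z ∈ L, InChamber g z := mem_filter.2 ⟨mem_univ _, z, hz, hg⟩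
    exact ⟨g, hmem, ((mem_filter.1 hmem).2.choose_spec.2).orderType_eq hg⟩

end Chambers

/-! ### Counting signed permutations that avoid the origin. -/

section Count

variable {V : Type*} [AddCommGroup V] [Module ℝ V] [FiniteDimensional ℝ V] {d k : ℕ}
  {η : Fin k → V}

/-- The walk with the signed and permuted increments `ε_{τ(l)} η_{τ(l)}`. -/
def signedPermWalk (η : Fin k → V) (g : Equiv.Perm (Fin k) × (Fin k → ℤˣ)) : Fin k → V :=
  walk fun l => ((g.2 (g.1 l) : ℤ) : ℝ) • η (g.1 l)

/-- Undoing the signs and the permutation sends relations of the new increments to relations of `η`,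
and the standard chamber to that of `g`. -/
theorem zero_mem_convexHull_signedPermWalk_iff (hk : 1 ≤ k) (hd : Module.finrank ℝ V = d)
    (h : Generic d η) (g : Equiv.Perm (Fin k) × (Fin k → ℤˣ)) :
    (0 : V) ∈ convexHull ℝ (Set.range (signedPermWalk η g)) ↔
      ∃ z ∈ LinearMap.ker (Fintype.linearCombination ℝ η), InChamber g z := by
  have hmul : ∀ e : ℤˣ, ((e : ℤ) : ℝ) * ((e : ℤ) : ℝ) = 1 := fun e => by
    rcases Int.units_eq_one_or e with rfl | rfl <;> simp
  rw [signedPermWalk, (h.signed_perm g.1 g.2).zero_mem_convexHull_walk_iff hk hd]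
  constructor
  · rintro ⟨z, hz, h1, h2⟩
    have hval : ∀ l, ((g.2 (g.1 l) : ℤ) : ℝ) *
        (((g.2 (g.1 l) : ℤ) : ℝ) * z (g.1.symm (g.1 l))) = z l := fun l => by
      rw [← mul_assoc, hmul, one_mul, Equiv.symm_apply_apply]
    refine ⟨fun j => ((g.2 j : ℤ) : ℝ) * z (g.1.symm j), ?_, ?_, ?_⟩
    · rw [LinearMap.mem_ker, Fintype.linearCombination_apply, ← hz, ← Equiv.sum_comp g.1]
      refine sum_congr rfl fun l _ => ?_
      rw [smul_smul, Equiv.symm_apply_apply, mul_comm]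
    · simpa only [hval] using h1
    · simpa only [hval] using h2
  · rintro ⟨z, hz, h1, h2⟩
    refine ⟨_, ?_, h1, h2⟩
    rw [LinearMap.mem_ker, Fintype.linearCombination_apply, ← Equiv.sum_comp g.1] at hz
    rw [← hz]
    refine sum_congr rfl fun l _ => ?_
    rw [smul_smul, mul_right_comm, hmul, one_mul]

open Classical in
/-- The number of signed permutations of generic increments for which the convex hull of the
walk avoids the origin. -/
theorem card_zero_notMem_convexHull (hk : 1 ≤ k) (hd : Module.finrank ℝ V = d)
    (h : Generic d η) :
    #(univ.filter fun g : Equiv.Perm (Fin k) × (Fin k → ℤˣ) =>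
      (0 : V) ∉ convexHull ℝ (Set.range (signedPermWalk η g))) = 2 * sumB k d := by
  have hcompl := card_filter_add_card_filter_not (s := univ)
    fun g : Equiv.Perm (Fin k) × (Fin k → ℤˣ) =>
      (0 : V) ∈ convexHull ℝ (Set.range (signedPermWalk η g))
  have htot : #(univ : Finset (Equiv.Perm (Fin k) × (Fin k → ℤˣ))) = 2 ^ k * k.factorial := by
    rw [card_univ, Fintype.card_prod, Fintype.card_perm, Fintype.card_fun, Fintype.card_fin,
      Fintype.card_units_int, mul_comm]
  simp only [zero_mem_convexHull_signedPermWalk_iff hk hd h] at hcompl ⊢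
  rw [card_inChamber, htot] at hcompl
  set L := LinearMap.ker (Fintype.linearCombination ℝ η) with hL
  have hgen : ∀ u ∈ L, u ≠ 0 → d < absCount (coordForm k) k u := by
    intro u hu h0
    rw [absCount_coordForm]
    exact h u (by rwa [hL, LinearMap.mem_ker, Fintype.linearCombination_apply] at hu) h0
  -- For d ≤ k, rank-nullity and genericity pin the codimension of the kernel to `d`. For d > k a
  -- nonzero relation would need more than `k` absolute values, so the kernel is zero and no chamber
  -- is met.
  rcases le_or_gt d k with hdk | hdk
  · have h1 := finrank_le_of_lt_absCount hdk hgen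
    have h2 := (Fintype.linearCombination ℝ η).finrank_range_add_finrank_ker
    have h3 := Submodule.finrank_le (LinearMap.range (Fintype.linearCombination ℝ η))
    rw [Module.finrank_fin_fun, ← hL] at h2
    have h4 := card_regions_add hk hdk (by lia) hgen
    lia
  · have h0 : #(regions (coordForm k) k L) = 0 := by
      rw [← card_inChamber, card_eq_zero, filter_eq_empty_iff]
      rintro g - ⟨z, hz, hg⟩
      rcases eq_or_ne z 0 with rfl | hz0
      · have := hg.2 ⟨0, hk⟩
        simp at this
      · have := hgen z hz hz0
        rw [absCount_coordForm] at this
        have := absCard_le z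
        lia
    rw [two_mul_sumB_of_le hk hdk.le]
    lia

end Count

/-! ### Cutting the increments into blocks and permuting the blocks. -/

section Blocks

variable {k n : ℕ}

/-- The indices `i 0 < i 1 < …` cut `Fin n` into consecutive blocks, the `l`-th of which ends
at `i l`; the indices after all of them get the label `⊤`. -/
noncomputable def blockMap (i : Fin k ↪o Fin n) (j : Fin n) : WithTop (Fin k) :=
  (univ.filter fun l => j ≤ i l).inf fun l => (l : WithTop (Fin k))

theorem blockMap_le_iff (i : Fin k ↪o Fin n) (j : Fin n) (l : Fin k) :
    blockMap i j ≤ l ↔ j ≤ i l := by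
  rw [blockMap, Finset.inf_le_iff (WithTop.coe_lt_top l)]
  simp only [mem_filter, mem_univ, true_and, WithTop.coe_le_coe]
  exact ⟨fun ⟨m, h1, h2⟩ => h1.trans (i.monotone h2), fun h => ⟨l, h, le_rfl⟩⟩

theorem withTop_le_of_forall {a b : WithTop (Fin k)} (h : ∀ l : Fin k, b ≤ l → a ≤ l) :
    a ≤ b := by
  induction b with
  | top => exact le_top
  | coe l => exact h l le_rfl

theorem blockMap_monotone (i : Fin k ↪o Fin n) : Monotone (blockMap i) := by
  intro j j' hj
  refine withTop_le_of_forall fun l hl => ?_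
  rw [blockMap_le_iff] at *
  exact hj.trans hl

theorem blockMap_apply (i : Fin k ↪o Fin n) (l : Fin k) : blockMap i (i l) = l := by
  refine le_antisymm ((blockMap_le_iff _ _ _).2 le_rfl) (withTop_le_of_forall fun m hm => ?_)
  rw [blockMap_le_iff] at hm
  exact WithTop.coe_le_coe.2 (i.le_iff_le.1 hm)

theorem blockMap_injective : Function.Injective (blockMap : (Fin k ↪o Fin n) → _) := by
  intro i i' h
  ext l : 1
  refine le_antisymm ?_ ?_
  · rw [← blockMap_le_iff, ← h, blockMap_le_iff]
  · rw [← blockMap_le_iff, h, blockMap_le_iff]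

theorem exists_blockMap_eq {b : Fin n → WithTop (Fin k)} (hb : Monotone b)
    (hs : ∀ l : Fin k, ∃ j, b j = l) : ∃ i : Fin k ↪o Fin n, blockMap i = b := by
  have hne : ∀ l : Fin k, (univ.filter fun j => b j ≤ l).Nonempty := fun l => by
    obtain ⟨j, hj⟩ := hs l
    exact ⟨j, by simp [hj]⟩
  let f : Fin k → Fin n := fun l => (univ.filter fun j => b j ≤ l).max' (hne l)
  have hf : ∀ j l, j ≤ f l ↔ b j ≤ l := by
    intro j l
    constructor
    · intro h
      have := max'_mem _ (hne l)
      rw [mem_filter] at this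
      exact (hb h).trans this.2
    · intro h
      exact le_max' _ j (by simpa using h)
  have hmono : StrictMono f := by
    intro l m hlm
    obtain ⟨j, hj⟩ := hs m
    refine lt_of_lt_of_le (not_le.1 fun h => ?_) ((hf j m).2 hj.le)
    rw [hf, hj, WithTop.coe_le_coe] at h
    exact h.not_gt hlm
  refine ⟨OrderEmbedding.ofStrictMono f hmono, funext fun j => ?_⟩
  have h : ∀ l : Fin k, blockMap (OrderEmbedding.ofStrictMono f hmono) j ≤ l ↔ b j ≤ l := by
    intro l
    rw [blockMap_le_iff]
    exact hf j l
  exact le_antisymm (withTop_le_of_forall fun l => (h l).2)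
    (withTop_le_of_forall fun l => (h l).1)

/-- Relabel the blocks by the inverse of `τ` and sort the indices by label; the tail labelled ⊤
stays last. -/
theorem exists_permuteBlocks (τ : Equiv.Perm (Fin k)) (i : Fin k ↪o Fin n) :
    ∃ (i' : Fin k ↪o Fin n) (σ : Equiv.Perm (Fin n)),
      blockMap i' = WithTop.map τ.symm ∘ blockMap i ∘ σ := by
  let b : Fin n → WithTop (Fin k) := WithTop.map τ.symm ∘ blockMap i
  obtain ⟨i', hi'⟩ := exists_blockMap_eq (Tuple.monotone_sort b) fun l =>
    ⟨(Tuple.sort b).symm (i (τ l)), by simp [b, blockMap_apply]⟩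
  exact ⟨i', Tuple.sort b, hi'⟩

/-- The indices whose blocks are those of `i`, permuted by `τ`. -/
noncomputable def permuteBlocks (τ : Equiv.Perm (Fin k)) (i : Fin k ↪o Fin n) :
    Fin k ↪o Fin n :=
  (exists_permuteBlocks τ i).choose

theorem permuteBlocks_spec (τ : Equiv.Perm (Fin k)) (i : Fin k ↪o Fin n) :
    ∃ σ : Equiv.Perm (Fin n),
      blockMap (permuteBlocks τ i) = WithTop.map τ.symm ∘ blockMap i ∘ σ :=
  (exists_permuteBlocks τ i).choose_spec

/-- Relabelling is invertible and a monotone labelling is determined by its multiset of labels, so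
the map is injective on a finite set. -/
theorem permuteBlocks_bijective (τ : Equiv.Perm (Fin k)) :
    Function.Bijective (permuteBlocks τ : (Fin k ↪o Fin n) → Fin k ↪o Fin n) := by
  classical
  have : Finite (Fin k ↪o Fin n) := Finite.of_injective _ DFunLike.coe_injective
  refine Finite.injective_iff_bijective.1 fun i i' h => blockMap_injective ?_
  obtain ⟨σ, hσ⟩ := permuteBlocks_spec τ i
  obtain ⟨σ', hσ'⟩ := permuteBlocks_spec τ i'
  have hinj : Function.Injective (WithTop.map τ.symm) := WithTop.map_injective τ.symm.injective
  have h1 : blockMap i ∘ σ = blockMap i' ∘ σ' := by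
    refine hinj.comp_left ?_
    change WithTop.map τ.symm ∘ blockMap i ∘ σ = WithTop.map τ.symm ∘ blockMap i' ∘ σ'
    rw [← hσ, ← hσ', h]
  have h2 : blockMap i ∘ (σ'.symm.trans σ : Equiv.Perm (Fin n)) = blockMap i' := by
    funext j
    simpa using congrFun h1 (σ'.symm j)
  rw [← h2]
  exact Tuple.unique_monotone (f := blockMap i) (σ := 1) (blockMap_monotone i)
    (h2 ▸ blockMap_monotone i')

/-- The sums of a family over the blocks of a labelling. -/
def blockSum {V : Type*} [AddCommMonoid V] (b : Fin n → WithTop (Fin k)) (x : Fin n → V) (l : Fin k) : V :=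
  ∑ j ∈ univ.filter (fun j => b j = l), x j

theorem walk_eq_walk_blockSum {V : Type*} [AddCommMonoid V] (x : Fin n → V) (i : Fin k ↪o Fin n) (l : Fin k) :
    walk x (i l) = walk (blockSum (blockMap i) x) l := by
  simp only [walk, blockSum]
  rw [← sum_biUnion]
  · refine sum_congr ?_ fun _ _ => rfl
    ext j
    simp only [mem_Iic, mem_biUnion, mem_filter, mem_univ, true_and, ← blockMap_le_iff]
    constructor
    · intro h
      obtain ⟨m, hm⟩ := WithTop.ne_top_iff_exists.1 (h.trans_lt (WithTop.coe_lt_top l)).ne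
      exact ⟨m, WithTop.coe_le_coe.1 (hm ▸ h), hm.symm⟩
    · rintro ⟨m, hm, h⟩
      rw [h]
      exact WithTop.coe_le_coe.2 hm
  · intro a _ b _ hab
    rw [Function.onFun, disjoint_left]
    intro j hj hj'
    rw [mem_filter] at hj hj'
    exact hab (WithTop.coe_injective (hj.2.symm.trans hj'.2))

variable {V : Type*} [AddCommGroup V] [Module ℝ V]

/-- Signs of the blocks, transported to the labels. -/
def labelSign (ε : Fin k → ℤˣ) (a : WithTop (Fin k)) : ℝ :=
  WithTop.recTopCoe 1 (fun l => ((ε l : ℤ) : ℝ)) a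

theorem labelSign_eq (ε : Fin k → ℤˣ) (a : WithTop (Fin k)) :
    labelSign ε a = -1 ∨ labelSign ε a = 1 := by
  induction a with
  | top => exact Or.inr rfl
  | coe l =>
    rcases Int.units_eq_one_or (ε l) with h | h
    · right; simp [labelSign, h]
    · left; simp [labelSign, h]

/-- The walk with signed and permuted block sums, seen as a walk with signed and permuted
increments at the indices with permuted blocks. -/
theorem signedPermWalk_blockSum (g : Equiv.Perm (Fin k) × (Fin k → ℤˣ)) {i i' : Fin k ↪o Fin n}
    {σ : Equiv.Perm (Fin n)} (h : blockMap i' = WithTop.map g.1.symm ∘ blockMap i ∘ σ)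
    (x : Fin n → V) (l : Fin k) :
    walk (fun j => labelSign g.2 (blockMap i (σ j)) • x (σ j)) (i' l) =
      signedPermWalk (blockSum (blockMap i) x) g l := by
  rw [walk_eq_walk_blockSum, signedPermWalk]
  congr 1
  funext m
  simp only [blockSum, smul_sum, h]
  refine sum_equiv σ (fun j => ?_) fun j hj => ?_
  · simp only [mem_filter, mem_univ, true_and, Function.comp_apply]
    rw [← (WithTop.map_injective g.1.symm.injective).eq_iff (b := ((g.1 m : Fin k) : WithTop _))]
    simp
  · simp only [mem_filter, mem_univ, true_and, Function.comp_apply] at hj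
    have : blockMap i (σ j) = ((g.1 m : Fin k) : WithTop (Fin k)) := by
      rw [← (WithTop.map_injective g.1.symm.injective).eq_iff, hj]
      simp
    rw [this]
    rfl

/-- A relation between block sums is one between the increments, constant on blocks and zero on the
tail, with the same nonzero absolute values. -/
theorem Generic.blockSum {d : ℕ} {x : Fin n → V} (h : Generic d x) (i : Fin k ↪o Fin n) :
    Generic d (blockSum (blockMap i) x) := by
  intro z hz h0
  let z' : Fin n → ℝ := fun j => WithTop.recTopCoe (C := fun _ => ℝ) 0 z (blockMap i j)
  have hz' : ∀ l, z' (i l) = z l := fun l => by simp [z', blockMap_apply]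
  have hsum : ∑ j, z' j • x j = 0 := by
    rw [← hz]
    simp only [ArcsineLaw.blockSum, smul_sum, sum_filter]
    rw [sum_comm]
    refine sum_congr rfl fun j _ => ?_
    simp only [z']
    cases blockMap i j with
    | top => simp
    | coe l => simp [WithTop.coe_inj]
  refine (h z' hsum fun h1 => h0 (funext fun l => ?_)).trans_le
    (absCard_le_of_forall_exists fun j hj => ?_)
  · rw [← hz', h1]; rfl
  · rcases hb : blockMap i j with _ | l
    · exact absurd (by simp [z', hb]; rfl) hj
    · exact ⟨l, by simp [z', hb]; rfl⟩

theorem Generic.castLE {d : ℕ} {x : Fin n → V} (h : Generic d x) (hkn : k ≤ n) :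
    Generic d fun l : Fin k => x (Fin.castLE hkn l) := by
  intro z hz h0
  let z' : Fin n → ℝ := fun j => if hj : (j : ℕ) < k then z ⟨j, hj⟩ else 0
  have hz' : ∀ l : Fin k, z' (Fin.castLE hkn l) = z l := fun l => by simp [z']
  have hsum : ∑ j, z' j • x j = 0 := by
    rw [← hz]
    symm
    refine sum_of_injOn (Fin.castLE hkn) (Fin.castLE_injective hkn).injOn (by simp) ?_ ?_
    · intro j _ hj
      have : ¬ (j : ℕ) < k := fun hjk => hj ⟨⟨j, hjk⟩, by simp, rfl⟩
      simp [z', this]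
    · intro l _
      rw [hz']
  refine (h z' hsum fun h1 => h0 (funext fun l => ?_)).trans_le
    (absCard_le_of_forall_exists fun j hj => ?_)
  · rw [← hz', h1]; rfl
  · by_cases hjk : (j : ℕ) < k
    · exact ⟨⟨j, hjk⟩, by simp [z', hjk]⟩
    · exact absurd (by simp [z', hjk]) hj

end Blocks

/-! ### Genericity from independence of walk positions. -/

section GeneralPosition

variable {V : Type*} [AddCommGroup V] [Module ℝ V]

/-- Suppose a relation has at most `d` nonzero absolute values. Sort it by absolute value and move
the signs into the increments: Abel summation yields a relation between at most `d` positions of a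
signed and permuted walk. -/
theorem generic_of_linearIndependent {d n : ℕ} (hdn : d ≤ n) {x : Fin n → V}
    (h : ∀ (τ : Equiv.Perm (Fin n)) (ε : Fin n → ℤˣ) (i : Fin d → Fin n), StrictMono i →
      LinearIndependent ℝ fun l => walk (fun j => ((ε j : ℤ) : ℝ) • x (τ j)) (i l)) :
    Generic d x := by
  intro z hz h0
  by_contra! hle
  let τ := Tuple.sort fun j => -|z j|
  let ε : Fin n → ℤˣ := fun j => if 0 < z (τ j) then 1 else -1
  let w : Fin n → ℝ := fun j => |z (τ j)|
  have hε : ∀ j, w j * ((ε j : ℤ) : ℝ) = z (τ j) := by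
    intro j
    simp only [ε, w]
    split_ifs with hj
    · simp [abs_of_pos hj]
    · simp [abs_of_nonpos (not_lt.1 hj)]
  have hanti : Antitone w := fun i j hij =>
    neg_le_neg_iff.1 (Tuple.monotone_sort (fun j => -|z j|) hij)
  have hw0 : ∀ j, 0 ≤ w j := fun j => abs_nonneg _
  have hsum : ∑ i, decrement w i • walk (fun j => ((ε j : ℤ) : ℝ) • x (τ j)) i = 0 := by
    rw [sum_smul_walk, tailSum_decrement, ← hz, ← Equiv.sum_comp τ fun j => z j • x j]
    exact sum_congr rfl fun j _ => by rw [smul_smul, hε]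
  have hcard : #(univ.filter fun i => decrement w i ≠ 0) ≤ d := by
    refine le_trans ?_ hle
    refine card_le_card_of_injOn w (fun i hi => ?_) fun i hi j hj hij => ?_
    · simp only [coe_filter, mem_univ, true_and, Set.mem_ofPred_eq] at hi
      simp only [coe_erase, coe_image]
      refine ⟨⟨τ i, by simp, rfl⟩, ?_⟩
      exact ne_zero_of_decrement_ne_zero hanti hw0 hi
    · simp only [coe_filter, mem_univ, true_and, Set.mem_ofPred_eq] at hi hj
      rcases lt_trichotomy i j with h1 | h1 | h1
      · exact absurd hij (lt_of_decrement_ne_zero hanti hi h1).ne'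
      · exact h1
      · exact absurd hij (lt_of_decrement_ne_zero hanti hj h1).ne
  -- Pad the support to exactly `d` indices, which is possible since d ≤ n.
  obtain ⟨P, hP, -, hPd⟩ := exists_subsuperset_card_eq (subset_univ _) hcard (by simpa using hdn)
  have hli := h τ ε (P.orderEmbOfFin hPd) (P.orderEmbOfFin hPd).strictMono
  rw [Fintype.linearIndependent_iff] at hli
  have hsum' : ∑ l : Fin d, decrement w (P.orderEmbOfFin hPd l) •
      walk (fun j => ((ε j : ℤ) : ℝ) • x (τ j)) (P.orderEmbOfFin hPd l) = 0 := by
    rw [← hsum]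
    refine sum_of_injOn (P.orderEmbOfFin hPd) (P.orderEmbOfFin hPd).injective.injOn (by simp) ?_
      fun _ _ => rfl
    intro j _ hj
    have : j ∉ P := by simpa using hj
    have : decrement w j = 0 := by
      by_contra hne
      exact this (hP (mem_filter.2 ⟨mem_univ _, hne⟩))
    rw [this, zero_smul]
  have hdec : decrement w = 0 := by
    funext j
    by_contra hne
    have hjP : j ∈ P := hP (mem_filter.2 ⟨mem_univ _, hne⟩)
    rw [← mem_coe, ← range_orderEmbOfFin P hPd] at hjP
    obtain ⟨l, rfl⟩ := hjP
    exact hne (hli _ hsum' l)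
  refine h0 (funext fun j => ?_)
  have h1 := congrFun (tailSum_decrement w) (τ.symm j)
  rw [hdec] at h1
  simp only [tailSum, Pi.zero_apply, sum_const_zero, w, Equiv.apply_symm_apply] at h1
  exact abs_eq_zero.1 h1.symm

end GeneralPosition

/-! ### Averaging over signed permutations of blocks. -/

section Probability

/-- The set is the projection, along the compact simplex of weights, of a closed set. -/
theorem isClosed_zero_mem_convexHull {V : Type*} [NormedAddCommGroup V] [NormedSpace ℝ V]
    (k : ℕ) : IsClosed {x : Fin k → V | (0 : V) ∈ convexHull ℝ (Set.range x)} := by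
  have h : {x : Fin k → V | (0 : V) ∈ convexHull ℝ (Set.range x)} =
      Prod.snd '' {p : stdSimplex ℝ (Fin k) × (Fin k → V) | ∑ i, p.1.1 i • p.2 i = 0} := by
    ext x
    simp only [Set.mem_ofPred_eq, zero_mem_convexHull_range_iff, Set.mem_image, Prod.exists,
      Subtype.exists, exists_eq_right, exists_prop]
  rw [h]
  refine isClosedMap_snd_of_compactSpace _ (isClosed_eq ?_ continuous_const)
  refine continuous_finsetSum _ fun i _ => Continuous.smul ?_ ?_
  · exact (continuous_apply i).comp (continuous_subtype_val.comp continuous_fst)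
  · exact (continuous_apply i).comp continuous_snd

variable {Ω : Type*} [MeasurableSpace Ω] {μ : Measure Ω} {d n k : ℕ}
  {ξ : Fin n → Ω → EuclideanSpace ℝ (Fin d)}

theorem measurableSet_zero_notMem_convexHull (k : ℕ) : MeasurableSet
    {x : Fin k → EuclideanSpace ℝ (Fin d) |
      (0 : EuclideanSpace ℝ (Fin d)) ∉ convexHull ℝ (Set.range x)} :=
  (isClosed_zero_mem_convexHull k).measurableSet.compl

theorem continuous_walk {V : Type*} [NormedAddCommGroup V] (i : Fin n) :
    Continuous fun x : Fin n → V => walk x i := by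
  unfold walk
  fun_prop

/-- A law invariant under signed permutations turns general position of the walk into
genericity of the increments. -/
theorem ae_generic (hdn : d ≤ n) (hEx : SymmExchangeable μ ξ) (hGP : GeneralPosition μ ξ) :
    ∀ᵐ ω ∂μ, Generic d fun j => ξ j ω := by
  have h : ∀ᵐ ω ∂μ, ∀ (τ : Equiv.Perm (Fin n)) (ε : Fin n → ℤˣ)
      (i : {i : Fin d → Fin n // StrictMono i}), LinearIndependent ℝ fun l =>
        walk (fun j => ((ε j : ℤ) : ℝ) • ξ (τ j) ω) (i.1 l) := by
    refine ae_all_iff.2 fun τ => ae_all_iff.2 fun ε => ae_all_iff.2 fun ⟨i, hi⟩ => ?_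
    have hid := hEx τ (fun j => ((ε j : ℤ) : ℝ)) fun j => by
      rcases Int.units_eq_one_or (ε j) with h | h <;> simp [h]
    have hS : MeasurableSet {x : Fin n → EuclideanSpace ℝ (Fin d) |
        ¬ LinearIndependent ℝ fun l => walk x (i l)} := by
      refine MeasurableSet.compl (IsOpen.measurableSet ?_)
      exact isOpen_setOfPred_linearIndependent.preimage
        (continuous_pi fun l => continuous_walk (i l))
    have := hid.measure_mem_eq hS
    rw [ae_iff]
    exact this.symm.trans (hGP i hi)
  filter_upwards [h] with ω hω
  exact generic_of_linearIndependent hdn fun τ ε i hi => hω τ ε ⟨i, hi⟩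

theorem sum_powersetCard_eq_sum_orderEmb (f : Set (Fin n) → ℝ) :
    ∑ I ∈ powersetCard k (univ : Finset (Fin n)), f I =
      ∑ i : Fin k ↪o Fin n, f (Set.range i) := by
  symm
  refine sum_bij (fun i _ => univ.map i.toEmbedding) ?_ ?_ ?_ ?_
  · intro i _
    simp [mem_powersetCard]
  · intro i _ i' _ h
    have h1 := congrArg (fun s : Finset (Fin n) => (s : Set (Fin n))) h
    simp only [coe_map, coe_univ, Set.image_univ] at h1
    exact OrderEmbedding.range_inj.1 h1
  · intro I hI
    have hc := (mem_powersetCard.1 hI).2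
    refine ⟨I.orderEmbOfFin hc, mem_univ _, ?_⟩
    rw [← coe_inj]
    simp
  · intro i _
    simp

theorem card_orderEmb : Fintype.card (Fin k ↪o Fin n) = n.choose k := by
  have := sum_powersetCard_eq_sum_orderEmb (k := k) (n := n) fun _ => 1
  simp only [sum_const, card_powersetCard, card_univ, Fintype.card_fin, nsmul_eq_mul,
    mul_one] at this
  exact_mod_cast this.symm

/-- The probability that the convex hull of the walk at the given indices avoids the origin. -/
noncomputable def avoidProb (μ : Measure Ω) (ξ : Fin n → Ω → EuclideanSpace ℝ (Fin d))
    (i : Fin k ↪o Fin n) : ℝ :=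
  μ.real {ω | (0 : EuclideanSpace ℝ (Fin d)) ∉
    convexHull ℝ (Set.range fun l => walk (fun j => ξ j ω) (i l))}

theorem measurable_walk_apply (hξ : ∀ i, Measurable (ξ i)) (i : Fin k → Fin n) :
    Measurable fun ω l => walk (fun j => ξ j ω) (i l) :=
  measurable_pi_iff.2 fun l =>
    (continuous_walk (i l)).measurable.comp (measurable_pi_iff.2 fun j => hξ j)

theorem integral_M_eq_sum_avoidProb [IsProbabilityMeasure μ] (hξ : ∀ i, Measurable (ξ i)) :
    ∫ ω, M k ξ ω ∂μ = 1 / 2 * ∑ i : Fin k ↪o Fin n, avoidProb μ ξ i := by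
  classical
  have hM : ∀ ω, M k ξ ω = 1 / 2 * ∑ i : Fin k ↪o Fin n,
      Set.indicator {ω | (0 : EuclideanSpace ℝ (Fin d)) ∉
        convexHull ℝ (Set.range fun l => walk (fun j => ξ j ω) (i l))} (fun _ => (1 : ℝ)) ω := by
    intro ω
    rw [M, halfCount]
    have := sum_powersetCard_eq_sum_orderEmb (k := k) fun I : Set (Fin n) =>
      if (0 : EuclideanSpace ℝ (Fin d)) ∉ convexHull ℝ (walk (fun j => ξ j ω) '' I)
        then (1 : ℝ) else 0
    rw [this]
    congr 1
    refine sum_congr rfl fun i _ => ?_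
    rw [Set.indicator_apply, ← Set.range_comp]
    rfl
  have hmeas : ∀ i : Fin k ↪o Fin n, MeasurableSet {ω | (0 : EuclideanSpace ℝ (Fin d)) ∉
      convexHull ℝ (Set.range fun l => walk (fun j => ξ j ω) (i l))} := fun i =>
    measurable_walk_apply hξ i (measurableSet_zero_notMem_convexHull k)
  simp only [hM]
  rw [integral_const_mul, integral_finsetSum]
  · congr 1
    refine sum_congr rfl fun i _ => ?_
    rw [integral_indicator_const _ (hmeas i), smul_eq_mul, mul_one]
    rfl
  · exact fun i _ => (integrable_const 1).indicator (hmeas i)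

/-- Blocks may differ in length, so permuting them changes the indices; the increments themselves
undergo only a signed permutation, which preserves their law. -/
theorem avoidProb_permuteBlocks (hEx : SymmExchangeable μ ξ)
    (g : Equiv.Perm (Fin k) × (Fin k → ℤˣ)) (i : Fin k ↪o Fin n) :
    avoidProb μ ξ (permuteBlocks g.1 i) =
      μ.real {ω | (0 : EuclideanSpace ℝ (Fin d)) ∉ convexHull ℝ (Set.range
        (signedPermWalk (blockSum (blockMap i) fun j => ξ j ω) g))} := by
  obtain ⟨σ, hσ⟩ := permuteBlocks_spec g.1 i
  have hid := hEx σ (fun j => labelSign g.2 (blockMap i (σ j))) fun j => labelSign_eq _ _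
  have hS : MeasurableSet {x : Fin n → EuclideanSpace ℝ (Fin d) |
      (0 : EuclideanSpace ℝ (Fin d)) ∉
        convexHull ℝ (Set.range fun l => walk x (permuteBlocks g.1 i l))} :=
    (continuous_pi fun l => continuous_walk (permuteBlocks g.1 i l)).measurable
      (measurableSet_zero_notMem_convexHull k)
  have h1 : ∀ ω, (fun l => walk (fun j => labelSign g.2 (blockMap i (σ j)) • ξ (σ j) ω)
      (permuteBlocks g.1 i l)) = signedPermWalk (blockSum (blockMap i) fun j => ξ j ω) g :=
    fun ω => funext fun l => signedPermWalk_blockSum g hσ (fun j => ξ j ω) l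
  simp only [← h1]
  exact congrArg ENNReal.toReal (hid.measure_mem_eq hS)

/-- Sum over pairs of a group element and an index choice. For a fixed choice, the sum over the
group is the expectation of an almost surely constant count; for a fixed group element, the choices
are merely permuted. -/
theorem sum_avoidProb [IsProbabilityMeasure μ] (hk : 1 ≤ k) (hξ : ∀ i, Measurable (ξ i))
    (hEx : SymmExchangeable μ ξ) (hgen : ∀ᵐ ω ∂μ, Generic d fun j => ξ j ω) :
    (2 ^ k * k.factorial : ℝ) * ∑ i : Fin k ↪o Fin n, avoidProb μ ξ i =
      n.choose k * (2 * sumB k d) := by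
  classical
  have hmeas : ∀ (i : Fin k ↪o Fin n) (g : Equiv.Perm (Fin k) × (Fin k → ℤˣ)),
      MeasurableSet {ω | (0 : EuclideanSpace ℝ (Fin d)) ∉ convexHull ℝ (Set.range
        (signedPermWalk (blockSum (blockMap i) fun j => ξ j ω) g))} := by
    intro i g
    have : Measurable fun ω => signedPermWalk (blockSum (blockMap i) fun j => ξ j ω) g := by
      unfold signedPermWalk blockSum walk
      fun_prop
    exact this (measurableSet_zero_notMem_convexHull k)
  have hfix : ∀ i : Fin k ↪o Fin n, ∑ g : Equiv.Perm (Fin k) × (Fin k → ℤˣ),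
      avoidProb μ ξ (permuteBlocks g.1 i) = 2 * sumB k d := by
    intro i
    have h1 : ∀ g : Equiv.Perm (Fin k) × (Fin k → ℤˣ), avoidProb μ ξ (permuteBlocks g.1 i) =
        ∫ ω, Set.indicator {ω | (0 : EuclideanSpace ℝ (Fin d)) ∉ convexHull ℝ (Set.range
          (signedPermWalk (blockSum (blockMap i) fun j => ξ j ω) g))} (fun _ => (1 : ℝ)) ω ∂μ := by
      intro g
      rw [integral_indicator_const _ (hmeas i g), smul_eq_mul, mul_one,
        avoidProb_permuteBlocks hEx]
    rw [sum_congr rfl fun g _ => h1 g, ← integral_finsetSum]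
    · have h2 : ∀ᵐ ω ∂μ, ∑ g : Equiv.Perm (Fin k) × (Fin k → ℤˣ),
          Set.indicator {ω | (0 : EuclideanSpace ℝ (Fin d)) ∉ convexHull ℝ (Set.range
            (signedPermWalk (blockSum (blockMap i) fun j => ξ j ω) g))} (fun _ => (1 : ℝ)) ω =
          2 * sumB k d := by
        filter_upwards [hgen] with ω hω
        have h3 := card_zero_notMem_convexHull hk (by simp) (hω.blockSum i)
        simp only [Set.indicator_apply, Set.mem_ofPred_eq]
        rw [sum_boole, h3]
        push_cast; ring
      rw [integral_congr_ae h2]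
      simp
    · exact fun g _ => (integrable_const 1).indicator (hmeas i g)
  have hperm : ∀ g : Equiv.Perm (Fin k) × (Fin k → ℤˣ),
      ∑ i : Fin k ↪o Fin n, avoidProb μ ξ (permuteBlocks g.1 i) =
        ∑ i : Fin k ↪o Fin n, avoidProb μ ξ i := fun g =>
    (permuteBlocks_bijective g.1).sum_comp fun i => avoidProb μ ξ i
  have htot : ((Fintype.card (Equiv.Perm (Fin k) × (Fin k → ℤˣ)) : ℕ) : ℝ) =
      2 ^ k * k.factorial := by
    rw [Fintype.card_prod, Fintype.card_perm, Fintype.card_fun, Fintype.card_fin,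
      Fintype.card_units_int]
    push_cast; ring
  have h1 := sum_congr (s₁ := univ) rfl fun g _ => hperm g
  rw [sum_comm, sum_congr rfl fun i _ => hfix i] at h1
  simp only [sum_const, card_univ, card_orderEmb, nsmul_eq_mul, htot] at h1
  exact h1.symm

/-- Genericity is assumed instead of general position because it passes to the first k increments
even for k < d, where general position is vacuous. -/
theorem integral_M [IsProbabilityMeasure μ] (hk : 1 ≤ k) (hξ : ∀ i, Measurable (ξ i))
    (hEx : SymmExchangeable μ ξ) (hgen : ∀ᵐ ω ∂μ, Generic d fun j => ξ j ω) :
    ∫ ω, M k ξ ω ∂μ = n.choose k * (sumB k d / (2 ^ k * k.factorial)) := by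
  have h := sum_avoidProb hk hξ hEx hgen
  have h0 : (2 ^ k * k.factorial : ℝ) ≠ 0 := by positivity
  rw [integral_M_eq_sum_avoidProb hξ]
  field_simp
  linear_combination h

/-- Extend the permutation by the identity and the signs by 1, then project. -/
theorem SymmExchangeable.castLE (hEx : SymmExchangeable μ ξ) (hkn : k ≤ n) :
    SymmExchangeable μ fun i : Fin k => ξ (Fin.castLE hkn i) := by
  intro σ ε hε
  have h := hEx (σ.viaFintypeEmbedding (Fin.castLEEmb hkn))
    (fun j => if hj : (j : ℕ) < k then ε ⟨j, hj⟩ else 1) fun j => by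
      split_ifs
      · exact hε _
      · exact Or.inr rfl
  have h2 := h.comp (u := fun x (l : Fin k) => x (Fin.castLE hkn l))
    (measurable_pi_iff.2 fun l => measurable_pi_apply _)
  have hval : ∀ l : Fin k,
      σ.viaFintypeEmbedding (Fin.castLEEmb hkn) (Fin.castLE hkn l) = Fin.castLE hkn (σ l) :=
    fun l => Equiv.Perm.viaFintypeEmbedding_apply_image σ (Fin.castLEEmb hkn) l
  simpa [Function.comp_def, hval] using h2

end Probability

/-! ### The discrete arcsine law. -/

section OneDimensional

/-- For d = 1 only the constant coefficient 1·3⋯(2k - 1) is left; its recursion is that of the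
central binomial coefficients. -/
theorem sumB_one_mul (k : ℕ) :
    (sumB k 1 : ℝ) / (2 ^ k * k.factorial) = 1 / 2 ^ (2 * k) * (2 * k).choose k := by
  have h : ∀ k : ℕ, sumB k 1 * 2 ^ k = k.factorial * (2 * k).choose k := by
    intro k
    induction k with
    | zero => simp [sumB_one, B]
    | succ k ih =>
      have h1 := Nat.succ_mul_centralBinom_succ k
      rw [Nat.centralBinom, Nat.centralBinom] at h1
      rw [sumB_succ_succ, sumB_zero, Nat.factorial_succ, pow_succ]
      linear_combination 2 * (2 * k + 1) * ih - k.factorial * h1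
  have hk := h k
  have hk' : (sumB k 1 : ℝ) * 2 ^ k = k.factorial * (2 * k).choose k := by exact_mod_cast hk
  rw [two_mul, pow_add, div_eq_iff (by positivity), ← two_mul]
  field_simp
  linear_combination hk'

theorem zero_notMem_convexHull_line {s : Set (EuclideanSpace ℝ (Fin 1))} :
    (0 : EuclideanSpace ℝ (Fin 1)) ∉ convexHull ℝ s ↔ (∀ x ∈ s, 0 < x 0) ∨ ∀ x ∈ s, x 0 < 0 := by
  constructor
  · intro h
    by_contra! hcon
    obtain ⟨⟨x, hx, hx0⟩, ⟨y, hy, hy0⟩⟩ := hcon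
    refine h ?_
    rcases eq_or_lt_of_le hx0 with hx1 | hx1
    · have : x = 0 := by ext i; fin_cases i; simpa using hx1
      exact this ▸ subset_convexHull ℝ s hx
    · have hpos : 0 < y 0 - x 0 := by linarith
      have hm := (convex_convexHull ℝ s) (subset_convexHull ℝ s hx) (subset_convexHull ℝ s hy)
        (a := y 0 / (y 0 - x 0)) (b := -x 0 / (y 0 - x 0)) (by positivity)
        (div_nonneg (by linarith) hpos.le) (by field_simp; ring)
      convert hm using 1
      ext i
      fin_cases i
      simp
      field_simp
      ring
  · intro h h0
    let c : EuclideanSpace ℝ (Fin 1) →ₗ[ℝ] ℝ := (EuclideanSpace.proj (0 : Fin 1)).toLinearMap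
    rcases h with h | h
    · have := convexHull_min (t := {x | 0 < c x}) (fun x hx => h x hx)
        (convex_halfSpace_gt c.isLinear 0) h0
      simp at this
    · have := convexHull_min (t := {x | c x < 0}) (fun x hx => h x hx)
        (convex_halfSpace_lt c.isLinear 0) h0
      simp at this

/-- On a line the hull avoids 0 when all chosen points lie strictly on one side; k ≥ 1 makes the two
sides exclusive. -/
theorem halfCount_line {n k : ℕ} (hk : 1 ≤ k) (x : Fin n → EuclideanSpace ℝ (Fin 1)) :
    halfCount k x = 1 / 2 * (((numPos fun i => x i 0).choose k : ℕ) +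
      ((numPos fun i => -x i 0).choose k : ℕ)) := by
  classical
  have hcount : ∀ y : Fin n → ℝ, (((numPos y).choose k : ℕ) : ℝ) =
      ∑ I ∈ powersetCard k univ, if ∀ i ∈ I, 0 < y i then 1 else 0 := by
    intro y
    rw [sum_boole, numPos, ← card_powersetCard]
    congr 2
    ext I
    simp only [mem_powersetCard, mem_filter, true_and, subset_iff, mem_univ]
    tauto
  rw [halfCount, hcount, hcount, ← sum_add_distrib]
  congr 1
  refine sum_congr rfl fun I hI => ?_
  obtain ⟨i, hi⟩ : I.Nonempty := card_pos.1 (by rw [(mem_powersetCard.1 hI).2]; exact hk)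
  simp only [zero_notMem_convexHull_line, Set.forall_mem_image, mem_coe, neg_pos]
  by_cases h1 : ∀ i ∈ I, 0 < x i 0
  · have h2 : ¬ ∀ i ∈ I, x i 0 < 0 := fun h => (h i hi).not_gt (h1 i hi)
    rw [if_pos (Or.inl h1), if_pos h1, if_neg h2, add_zero]
  · by_cases h2 : ∀ i ∈ I, x i 0 < 0
    · rw [if_pos (Or.inr h2), if_neg h1, if_pos h2, zero_add]
    · rw [if_neg (not_or.2 ⟨h1, h2⟩), if_neg h1, if_neg h2, add_zero]

theorem walk_neg {V : Type*} [AddCommGroup V] {n : ℕ} (x : Fin n → V) (i : Fin n) :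
    walk (fun j => -x j) i = -walk x i := by
  simp [walk]

theorem measurable_numPos {n : ℕ} : Measurable (numPos : (Fin n → ℝ) → ℕ) := by
  have h : (numPos : (Fin n → ℝ) → ℕ) = fun x => ∑ i, if 0 < x i then 1 else 0 := by
    funext x
    rw [numPos, card_filter]
  rw [h]
  refine Finset.measurable_sum _ fun i _ => ?_
  exact Measurable.ite (measurableSet_lt measurable_const (measurable_pi_apply i))
    measurable_const measurable_const

/-- Flipping all signs exchanges positive and negative terms without changing the law, so the two
halves of `halfCount_line` have equal expectation. -/
theorem integral_choose_numPos {Ω : Type*} [MeasurableSpace Ω] {μ : Measure Ω}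
    [IsProbabilityMeasure μ] {n k : ℕ} {ξ : Fin n → Ω → EuclideanSpace ℝ (Fin 1)} (hk : 1 ≤ k)
    (hξ : ∀ i, Measurable (ξ i)) (hEx : SymmExchangeable μ ξ) :
    ∫ ω, (((numPos fun i => walk (fun j => ξ j ω) i 0).choose k : ℕ) : ℝ) ∂μ =
      ∫ ω, M k ξ ω ∂μ := by
  let F : (Fin n → EuclideanSpace ℝ (Fin 1)) → ℝ :=
    fun x => (((numPos fun i => walk x i 0).choose k : ℕ) : ℝ)
  have hF : Measurable F := by
    have h1 : Measurable fun x : Fin n → EuclideanSpace ℝ (Fin 1) => fun i => walk x i 0 :=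
      measurable_pi_iff.2 fun i =>
        ((EuclideanSpace.proj (𝕜 := ℝ) (0 : Fin 1)).continuous.comp
          (continuous_walk i)).measurable
    have h2 : Measurable fun m : ℕ => ((m.choose k : ℕ) : ℝ) := measurable_from_top
    exact h2.comp (measurable_numPos.comp h1)
  have hid := hEx 1 (fun _ => -1) fun _ => Or.inl rfl
  have hneg : ∫ ω, F (fun j => ξ j ω) ∂μ = ∫ ω, F (fun j => -ξ j ω) ∂μ := by
    have := (hid.comp hF).integral_eq
    simpa [Function.comp_def] using this
  have hint : ∀ ζ : Ω → Fin n → EuclideanSpace ℝ (Fin 1), Measurable ζ →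
      Integrable (fun ω => F (ζ ω)) μ := by
    intro ζ hζ
    refine Integrable.of_bound (hF.comp hζ).aestronglyMeasurable (n.choose k : ℝ)
      (Filter.Eventually.of_forall fun ω => ?_)
    rw [Real.norm_eq_abs, Nat.abs_cast, Nat.cast_le]
    refine Nat.choose_le_choose k ((card_filter_le _ _).trans (by simp))
  have hM : ∀ ω, M k ξ ω = 1 / 2 * (F (fun j => ξ j ω) + F (fun j => -ξ j ω)) := by
    intro ω
    rw [M, halfCount_line hk]
    simp only [F, walk_neg]
    rfl
  simp only [hM]
  rw [integral_const_mul, integral_add (hint _ (measurable_pi_iff.2 hξ))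
    (hint (fun ω j => -ξ j ω) (measurable_pi_iff.2 fun i => (hξ i).neg)), ← hneg]
  change ∫ ω, F (fun j => ξ j ω) ∂μ = _
  ring

end OneDimensional

end ArcsineLaw

/-- In the second formula, `fun i : Fin k => ξ (Fin.castLE hkn i)` are the first `k` increments.
The last part is the one-dimensional case, stated for the number of positive terms. -/
theorem theorem1p2 {Ω : Type*} [MeasurableSpace Ω] (μ : MeasureTheory.Measure Ω)
    [MeasureTheory.IsProbabilityMeasure μ] (d n : ℕ) (hd : 1 ≤ d) (hn : d + 1 ≤ n)
    (ξ : Fin n → Ω → EuclideanSpace ℝ (Fin d)) (hξ : ∀ i, Measurable (ξ i))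
    (hEx : ArcsineLaw.SymmExchangeable μ ξ) (hGP : ArcsineLaw.GeneralPosition μ ξ)
    (k : ℕ) (hk : 1 ≤ k) (hkn : k ≤ n) :
    (∫ ω, ArcsineLaw.M k ξ ω ∂μ
        = (n.choose k : ℝ) * ((ArcsineLaw.sumB k d : ℝ) / (2 ^ k * (k.factorial : ℝ)))) ∧
    (∫ ω, ArcsineLaw.M k ξ ω ∂μ
        = (n.choose k : ℝ) *
          ∫ ω, ArcsineLaw.M k (fun i : Fin k => ξ (Fin.castLE hkn i)) ω ∂μ) ∧
    (d = 1 →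
      ∫ ω, (((ArcsineLaw.numPos
          (fun i => ArcsineLaw.walk (fun j => ξ j ω) i ⟨0, hd⟩)).choose k : ℕ) : ℝ) ∂μ
        = 1 / 2 ^ (2 * k) * ((2 * k).choose k : ℝ) * (n.choose k : ℝ)) := by
  have hgen := ArcsineLaw.ae_generic (by lia) hEx hGP
  have h1 := ArcsineLaw.integral_M hk hξ hEx hgen
  refine ⟨h1, ?_, ?_⟩
  -- The same formula for the first `k` increments has binomial factor 1.
  · rw [h1, ArcsineLaw.integral_M hk (fun i => hξ _) (hEx.castLE hkn)
      (hgen.mono fun ω hω => hω.castLE hkn), Nat.choose_self, Nat.cast_one, one_mul]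
  · rintro rfl
    have h2 := ArcsineLaw.integral_choose_numPos hk hξ hEx
    rw [h1, ArcsineLaw.sumB_one_mul] at h2
    refine h2.trans ?_
    ring
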